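/- Proposition 3.1 (lower bound for $\alpha$-biRic). Put $a_3=1,\ a_4=\tfrac{11}{10},\ a_5=\tfrac{111}{100}$ and $\alpha_3=\alpha_4=1,\ \alpha_5=\tfrac{93}{100}$. Let $n\in\{3,4,5\}$ and $H\in\mathbb R\setminus\{0\}$. There is a constant $\delta_n>0$, depending only on $n$ and $H$, such that the following holds. Let $M^n\hookrightarrow\mathbb R^{n+1}$ be a complete noncompact immersed (smooth, connected) hypersurface with the induced metric $g$, with constant mean curvature $H$ (the trace of the second fundamental form $A$, for a suitable choice of unit normal) and with finite index. Let $o\in M$ be any base point and let $B_R$ denote the intrinsic ball of radius $R$ about $o$. Say that $M\setminus B_R$ is stable if $\int_M|A|^2\varphi^2\le\int_M|\nabla\varphi|_g^2$ for all $\varphi\in C^1_c(M\setminus B_R)$. Then: 1. $M\setminus B_{R_0}$ is stable for all sufficiently large $R_0$; 2. for every $R_0>0$ such that $M\setminus B_{R_0}$ is stable and every $\varphi\in C_c^1(M\setminus B_{R_0})$, $$\int_{M}|\nabla \varphi|_{g}^2-\frac{1}{a_n}\bigl(\delta_n-\operatorname{biRic}_{\alpha_{n}}\bigr)\varphi^2\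 \ge\ 0,$$ the integrand being integrable. Here $C^1_c(S)$, for $S\subseteq M$, is the space of $C^1$ functions on $M$ whose support is compact and contained in $S$, and $$\operatorname{biRic}_\alpha(p)=\min\{\operatorname{Ric}_M(x,x)+\alpha\operatorname{Ric}_M(y,y)-\alpha R_M(x,y,x,y): x,y\in T_pM \text{ orthonormal}\},$$ where $\operatorname{Ric}_M$ and $R_M$ are the Ricci and Riemann curvature of $g$, with the sign for which $R_M(x,y,x,y)$ is the sectional curvature of the plane of orthonormal $x,y$. Finite index means that $\sup_i\operatorname{Ind}(\Omega_i)<\infty$ for an exhaustion $\Omega_1\subset\Omega_2\subset\cdots$ of $M$ by relatively compact open sets, where $\operatorname{Ind}(\Omega)$ is the number of $k\ge1$ with $\lambda_k(\Omega)<0$, and $$\lambda_k(\Omega)=\inf_{V\subset C^1_c(\Omega),\ \dim V=k}\ \sup_{u\in V\setminus\{0\}}\frac{\int_M|\nabla u|^2-|A|^2u^2}{\int_M u^2}$$ is the $k$-th Dirichlet eigenvalue (counted with multiplicity) of the Jacobi operator $J=\Delta_M+|A|^2$ on $\Omega$, that is, of $Ju+\lambda u=0$. -/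

import Mathlib

open Bundle
open scoped Manifold ContDiff

noncomputable section

namespace CMC

open MeasureTheory

/-- The tangent spaces of an `n`-manifold are finite-dimensional. -/
instance finiteDimensional_tangentSpace (n : ℕ) {M : Type*} [TopologicalSpace M]
    [ChartedSpace (EuclideanSpace ℝ (Fin n)) M] (p : M) :
    FiniteDimensional ℝ (TangentSpace (𝓡 n) p) :=
  inferInstanceAs (FiniteDimensional ℝ (EuclideanSpace ℝ (Fin n)))

/-! ## Intrinsic Riemannian geometry

`M` is a smooth manifold modelled on `ℝⁿ`, with a Riemannian metric on its tangent bundle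
(`RiemannianBundle`). -/

section Intrinsic

variable (n : ℕ) {M : Type*} [TopologicalSpace M] [ChartedSpace (EuclideanSpace ℝ (Fin n)) M]
  [RiemannianBundle (fun x : M => TangentSpace (𝓡 n) x)]

/-- The partial derivative `∂ᵢ f` at `y` of a function on `ℝⁿ`. -/
def partialDeriv (i : Fin n) (f : EuclideanSpace ℝ (Fin n) → ℝ)
    (y : EuclideanSpace ℝ (Fin n)) : ℝ :=
  fderiv ℝ f y (EuclideanSpace.single i 1)

/-- The coordinate vector field `∂ᵢ` of the chart at `p`, at the point of coordinates `y`. -/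
def coordVector (p : M) (y : EuclideanSpace ℝ (Fin n)) (i : Fin n) :
    TangentSpace (𝓡 n) ((extChartAt (𝓡 n) p).symm y) :=
  mfderiv 𝓘(ℝ, EuclideanSpace ℝ (Fin n)) (𝓡 n) (extChartAt (𝓡 n) p).symm y
    (EuclideanSpace.single i (1 : ℝ) : EuclideanSpace ℝ (Fin n))

/-- The matrix `g_{ij} = ⟨∂ᵢ, ∂ⱼ⟩` of the metric in the chart at `p`. -/
def chartMetric (p : M) (y : EuclideanSpace ℝ (Fin n)) : Matrix (Fin n) (Fin n) ℝ :=
  Matrix.of fun i j => inner ℝ (coordVector n p y i) (coordVector n p y j)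

/-- Christoffel symbols of the Levi-Civita connection in the chart at `p`:
`Γᵏᵢⱼ = ½ ∑ₗ gᵏˡ (∂ᵢ g_{jl} + ∂ⱼ g_{il} - ∂ₗ g_{ij})`. -/
def christoffel (p : M) (k i j : Fin n) (y : EuclideanSpace ℝ (Fin n)) : ℝ :=
  (1 / 2) * ∑ l, (chartMetric n p y)⁻¹ k l *
    (partialDeriv n i (fun z => chartMetric n p z j l) y
      + partialDeriv n j (fun z => chartMetric n p z i l) y
      - partialDeriv n l (fun z => chartMetric n p z i j) y)

/-- The components of the curvature tensor at `p` in the chart at `p`: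
`R(∂ᵢ, ∂ⱼ) ∂ₖ = ∑ₗ (curvatureCoeff p i j k l) ∂ₗ`, where `R(X, Y) = [∇_X, ∇_Y] - ∇_{[X, Y]}`. -/
def curvatureCoeff (p : M) (i j k l : Fin n) : ℝ :=
  let y := extChartAt (𝓡 n) p p
  partialDeriv n i (christoffel n p l j k) y - partialDeriv n j (christoffel n p l i k) y
    + ∑ m, (christoffel n p l i m y * christoffel n p m j k y
      - christoffel n p l j m y * christoffel n p m i k y)

/-- The `i`-th component of a tangent vector at `p` in the chart at `p`. -/
def coord (p : M) (v : TangentSpace (𝓡 n) p) (i : Fin n) : ℝ :=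
  let ξ : TangentSpace (𝓡 n) p →L[ℝ] EuclideanSpace ℝ (Fin n) :=
    mfderiv (𝓡 n) 𝓘(ℝ, EuclideanSpace ℝ (Fin n)) (extChartAt (𝓡 n) p) p
  ξ v i

/-- The Riemann curvature tensor `R_M(x, y, z, w) = ⟨R(x, y) w, z⟩` at `p`; the sign is such that
`R_M(x, y, x, y)` is the sectional curvature of the plane spanned by orthonormal `x, y`. -/
def riemann (p : M) (x y z w : TangentSpace (𝓡 n) p) : ℝ :=
  ∑ i, ∑ j, ∑ k, ∑ l, ∑ m,
    coord n p x i * coord n p y j * coord n p w k * coord n p z m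
      * curvatureCoeff n p i j k l * chartMetric n p (extChartAt (𝓡 n) p p) l m

/-- The Ricci curvature `Ric_M(x, x) = ∑ᵢ R_M(eᵢ, x, eᵢ, x)`, for an orthonormal basis `eᵢ` of
the tangent space. -/
def ricci (p : M) (x : TangentSpace (𝓡 n) p) : ℝ :=
  let e := stdOrthonormalBasis ℝ (TangentSpace (𝓡 n) p)
  ∑ i, riemann n p (e i) x (e i) x

/-- The `α`-biRic curvature operator
`biRic_α(x, y) = Ric(x, x) + α Ric(y, y) - α R_M(x, y, x, y)`. -/
def biRicOp (α : ℝ) (p : M) (x y : TangentSpace (𝓡 n) p) : ℝ :=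
  ricci n p x + α * ricci n p y - α * riemann n p x y x y

/-- The `α`-biRic curvature at `p`: the minimum of `biRic_α(x, y)` over all pairs of orthonormal
tangent vectors at `p`. (That set of pairs is compact, and it is non-empty for `2 ≤ n`, so the
infimum is a minimum.) -/
def biRic (α : ℝ) (p : M) : ℝ :=
  sInf {r | ∃ x y : TangentSpace (𝓡 n) p, ‖x‖ = 1 ∧ ‖y‖ = 1 ∧ inner ℝ x y = 0 ∧
    r = biRicOp n α p x y}

/-- `|∇φ|²` at `p`, as the square of the norm of the linear form `dφ_p` on `T_pM`. -/
def gradSq (φ : M → ℝ) (p : M) : ℝ :=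
  let dφ : TangentSpace (𝓡 n) p →L[ℝ] ℝ := mfderiv (𝓡 n) 𝓘(ℝ, ℝ) φ p
  ‖dφ‖ ^ 2

end Intrinsic

/-- `φ ∈ C¹_c(S)`: a compactly supported `C¹` function on `M` whose support lies in `S`. -/
def IsTestFunction (n : ℕ) {M : Type*} [TopologicalSpace M]
    [ChartedSpace (EuclideanSpace ℝ (Fin n)) M] (S : Set M) (φ : M → ℝ) : Prop :=
  ContMDiff (𝓡 n) 𝓘(ℝ, ℝ) 1 φ ∧ HasCompactSupport φ ∧ tsupport φ ⊆ S

/-! ## Immersed hypersurfaces of `ℝⁿ⁺¹` -/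

section Extrinsic

variable {n : ℕ} {M : Type*} [TopologicalSpace M] [ChartedSpace (EuclideanSpace ℝ (Fin n)) M]
  [RiemannianBundle (fun x : M => TangentSpace (𝓡 n) x)]

/-- The differential of `F : M → ℝⁿ⁺¹` at `p`. -/
def differential (F : M → EuclideanSpace ℝ (Fin (n + 1))) (p : M) :
    TangentSpace (𝓡 n) p →L[ℝ] EuclideanSpace ℝ (Fin (n + 1)) :=
  mfderiv (𝓡 n) 𝓘(ℝ, EuclideanSpace ℝ (Fin (n + 1))) F p

/-- `F` is a smooth immersion into `ℝⁿ⁺¹` and the metric of `M` is the induced one. -/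
def IsIsometricImmersion (F : M → EuclideanSpace ℝ (Fin (n + 1))) : Prop :=
  ContMDiff (𝓡 n) 𝓘(ℝ, EuclideanSpace ℝ (Fin (n + 1))) ∞ F ∧
    ∀ (p : M) (v w : TangentSpace (𝓡 n) p),
      inner ℝ (differential F p v) (differential F p w) = inner ℝ v w

/-- The (vector valued) second fundamental form at `p`: the component normal to `dF(T_pM)` of the
second derivative of `F`, read in the chart at `p`. For a local unit normal `ν` it equals
`A(v, w) ν`, where `A` is the scalar second fundamental form with respect to `ν`. -/
def secondFundamentalForm (F : M → EuclideanSpace ℝ (Fin (n + 1))) (p : M)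
    (v w : TangentSpace (𝓡 n) p) : EuclideanSpace ℝ (Fin (n + 1)) :=
  let G : EuclideanSpace ℝ (Fin n) → EuclideanSpace ℝ (Fin (n + 1)) :=
    F ∘ (extChartAt (𝓡 n) p).symm
  let ξ : TangentSpace (𝓡 n) p →L[ℝ] EuclideanSpace ℝ (Fin n) :=
    mfderiv (𝓡 n) 𝓘(ℝ, EuclideanSpace ℝ (Fin n)) (extChartAt (𝓡 n) p) p
  (LinearMap.range (differential F p).toLinearMap)ᗮ.starProjection
    (fderiv ℝ (fderiv ℝ G) (extChartAt (𝓡 n) p p) (ξ v) (ξ w))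

/-- `|A|²` at `p`, the squared norm of the second fundamental form. -/
def normSqA (F : M → EuclideanSpace ℝ (Fin (n + 1))) (p : M) : ℝ :=
  let e := stdOrthonormalBasis ℝ (TangentSpace (𝓡 n) p)
  ∑ i, ∑ j, ‖secondFundamentalForm F p (e i) (e j)‖ ^ 2

/-- The mean curvature vector at `p`, the trace of the second fundamental form. -/
def meanCurvatureVector (F : M → EuclideanSpace ℝ (Fin (n + 1))) (p : M) :
    EuclideanSpace ℝ (Fin (n + 1)) :=
  let e := stdOrthonormalBasis ℝ (TangentSpace (𝓡 n) p)
  ∑ i, secondFundamentalForm F p (e i) (e i)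

/-- The hypersurface has constant mean curvature `H` for a suitable choice of local unit normals:
the mean curvature vector has constant length `|H|`. When `H ≠ 0`, the mean curvature vector
divided by `H` is then a global unit normal for which the scalar mean curvature is `H`; in
particular two-sidedness is automatic. -/
def HasConstantMeanCurvature (F : M → EuclideanSpace ℝ (Fin (n + 1))) (H : ℝ) : Prop :=
  ∀ p, ‖meanCurvatureVector F p‖ = |H|

end Extrinsic

/-! ## Stability and index

From here on `M` is a metric space and its distance will be the Riemannian one, so that the
`n`-dimensional Hausdorff measure `μHE[n]`, normalized to agree with Lebesgue measure on `ℝⁿ`, is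
the Riemannian volume measure. -/

section Index

variable {n : ℕ} {M : Type*} [MetricSpace M] [MeasurableSpace M] [BorelSpace M]
  [ChartedSpace (EuclideanSpace ℝ (Fin n)) M]
  [RiemannianBundle (fun x : M => TangentSpace (𝓡 n) x)]

/-- The quadratic form `∫_M |∇u|² - |A|² u²` of the Jacobi operator `J = Δ + |A|²`. -/
def jacobiForm (F : M → EuclideanSpace ℝ (Fin (n + 1))) (u : M → ℝ) : ℝ :=
  ∫ p, (gradSq n u p - normSqA F p * u p ^ 2) ∂μHE[n]

/-- The set `S` is (strongly) stable: `∫_M |A|² φ² ≤ ∫_M |∇φ|²` for all `φ ∈ C¹_c(S)`. -/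
def IsStableOn (F : M → EuclideanSpace ℝ (Fin (n + 1))) (S : Set M) : Prop :=
  ∀ φ : M → ℝ, IsTestFunction n S φ →
    ∫ p, normSqA F p * φ p ^ 2 ∂μHE[n] ≤ ∫ p, gradSq n φ p ∂μHE[n]

/-- The `k`-th Dirichlet eigenvalue (`k ≥ 1`, repeated with multiplicity, in increasing order) of
the Jacobi operator on the open set `Ω`, i.e. of `J u + λ u = 0`, in its min-max form: the infimum
over the `k`-dimensional spaces `V` of `C¹` functions with compact support in `Ω` of the maximum
over `V \ {0}` of the Rayleigh quotient `∫ (|∇u|² - |A|² u²) / ∫ u²`. -/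
def dirichletEigenvalue (F : M → EuclideanSpace ℝ (Fin (n + 1))) (Ω : Set M) (k : ℕ) : EReal :=
  ⨅ (V : Submodule ℝ (M → ℝ)) (_ : Module.finrank ℝ V = k) (_ : ∀ u ∈ V, IsTestFunction n Ω u),
    ⨆ (u : M → ℝ) (_ : u ∈ V) (_ : u ≠ 0),
      ((jacobiForm F u / ∫ p, u p ^ 2 ∂μHE[n] : ℝ) : EReal)

/-- `Ind(Ω)`: the number of negative Dirichlet eigenvalues of the Jacobi operator on `Ω`, counted
with multiplicity. -/
def index (F : M → EuclideanSpace ℝ (Fin (n + 1))) (Ω : Set M) : ℕ∞ :=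
  {k : ℕ | 1 ≤ k ∧ dirichletEigenvalue F Ω k < 0}.encard

/-- An exhaustion of `M` by relatively compact open sets. -/
def IsExhaustion {M : Type*} [TopologicalSpace M] (Ω : ℕ → Set M) : Prop :=
  (∀ i, IsOpen (Ω i)) ∧ (∀ i, IsCompact (closure (Ω i))) ∧
    (∀ i, closure (Ω i) ⊆ Ω (i + 1)) ∧ ⋃ i, Ω i = Set.univ

/-- The hypersurface has finite index: `sup_i Ind(Ω_i) < ∞` for an exhaustion `Ω_i`. (As `Ind` is
monotone with respect to inclusion, the supremum does not depend on the exhaustion.) -/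
def HasFiniteIndex (F : M → EuclideanSpace ℝ (Fin (n + 1))) : Prop :=
  ∃ Ω : ℕ → Set M, IsExhaustion Ω ∧ ⨆ i, index F (Ω i) < ⊤

end Index

/-- The constants `a_n`. -/
def aConst (n : ℕ) : ℝ :=
  if n = 5 then 111 / 100 else if n = 4 then 11 / 10 else 1

/-- The constants `α_n`. -/
def alphaConst (n : ℕ) : ℝ :=
  if n = 5 then 93 / 100 else 1

end CMC

end

/-! The estimate is pointwise: a_n|A|² + biRic_{α_n} ≥ δ_n with δ_n = H²/1000. Stability gives
∫|A|²φ² ≤ ∫|∇φ|², and replacing |A|² by the smaller (δ_n - biRic)/a_n proves the second claim.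

For the pointwise bound, the Gauss equation (`riemann_eq`) writes every curvature in terms of A. In
an orthonormal basis starting with x, y, the expression a_n|A|² + biRic_{α_n}(x,y) splits into a
quadratic form in the diagonal entries of A and a combination of squares of the off-diagonal ones.
The coefficients of the squares are nonnegative, and for the chosen a_n, α_n the diagonal form
dominates a small multiple of (tr A)² = H² (`gaussBiRic_lower_bound`). As curvature is defined by
Christoffel symbols in charts, the Gauss equation is first proved for a parametrization G in terms
of its derivatives.

For stability at infinity, instability outside arbitrarily large balls would produce infinitely many
unstable functions with disjoint supports. The span of any k of them makes λ_k negative on a large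
Ω_i (`dirichletEigenvalue_neg`), which contradicts finite index.

Integrability requires finite volume of compact sets, continuity of |A|² and |∇φ|², and
measurability and local boundedness of biRic. The last comes from upper semicontinuity together with
the pointwise lower bound. -/

namespace CMC
-- Algebra of symmetric bilinear forms: the pointwise inequality.
section LinearAlgebra

variable {V : Type*} [NormedAddCommGroup V] [InnerProductSpace ℝ V]

/-- The trace of a bilinear form does not depend on the orthonormal basis. -/
theorem sum_bilin_orthonormalBasis {ι κ : Type*} [Fintype ι] [Fintype κ]
    (B : V →ₗ[ℝ] V →ₗ[ℝ] ℝ) (e : OrthonormalBasis ι ℝ V) (b : OrthonormalBasis κ ℝ V) :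
    ∑ i, B (e i) (e i) = ∑ k, B (b k) (b k) := by
  have h1 : ∀ i, B (e i) (e i) =
      ∑ k, ∑ l, (inner ℝ (b k) (e i) * inner ℝ (e i) (b l)) * B (b k) (b l) := by
    intro i
    conv_lhs => rw [← b.sum_repr' (e i)]
    simp only [map_sum, map_smul, LinearMap.sum_apply, LinearMap.smul_apply, smul_eq_mul,
      Finset.mul_sum]
    rw [Finset.sum_comm]
    refine Finset.sum_congr rfl fun k _ => Finset.sum_congr rfl fun l _ => ?_
    rw [real_inner_comm (b l) (e i)]
    ring
  simp_rw [h1]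
  rw [Finset.sum_comm]
  refine Finset.sum_congr rfl fun k _ => ?_
  rw [Finset.sum_comm]
  classical
  simp_rw [← Finset.sum_mul, e.sum_inner_mul_inner, orthonormal_iff_ite.mp b.orthonormal]
  simp

/-- The squared Hilbert–Schmidt norm of a bilinear form does not depend on the orthonormal
basis. -/
theorem sum_sq_bilin_orthonormalBasis {ι κ : Type*} [Fintype ι] [Fintype κ]
    (B : V →ₗ[ℝ] V →ₗ[ℝ] ℝ) (e : OrthonormalBasis ι ℝ V) (b : OrthonormalBasis κ ℝ V) :
    ∑ i, ∑ j, B (e i) (e j) ^ 2 = ∑ k, ∑ l, B (b k) (b l) ^ 2 := by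
  -- Change basis in one slot at a time: with v fixed, the sum is the trace of the rank-one form (a,
  -- b) ↦ B(v,a) B(v,b).
  have h1 : ∀ v, ∑ j, B v (e j) ^ 2 = ∑ l, B v (b l) ^ 2 := by
    intro v
    have := sum_bilin_orthonormalBasis ((LinearMap.lsmul ℝ ℝ).compl₁₂ (B v) (B v)) e b
    simpa [pow_two] using this
  simp_rw [h1]
  rw [Finset.sum_comm]
  conv_rhs => rw [Finset.sum_comm]
  refine Finset.sum_congr rfl fun l _ => ?_
  have := sum_bilin_orthonormalBasis
    ((LinearMap.lsmul ℝ ℝ).compl₁₂ (B.flip (b l)) (B.flip (b l))) e b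
  simpa [pow_two] using this

/-- The `α`-biRic operator of a symmetric bilinear form, as given by the Gauss equation. -/
noncomputable def gaussBiRic {ι : Type*} [Fintype ι] (α : ℝ) (A : V →ₗ[ℝ] V →ₗ[ℝ] ℝ)
    (e : OrthonormalBasis ι ℝ V) (x y : V) : ℝ :=
  ∑ i, (A (e i) (e i) * A x x - A (e i) x ^ 2)
    + α * ∑ i, (A (e i) (e i) * A y y - A (e i) y ^ 2)
    - α * (A x x * A y y - A x y ^ 2)

theorem gaussBiRic_eq {ι κ : Type*} [Fintype ι] [Fintype κ] (α : ℝ) (A : V →ₗ[ℝ] V →ₗ[ℝ] ℝ)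
    (e : OrthonormalBasis ι ℝ V) (b : OrthonormalBasis κ ℝ V) (x y : V) :
    gaussBiRic α A e x y = gaussBiRic α A b x y := by
  have h : ∀ v, ∑ i, (A (e i) (e i) * A v v - A (e i) v ^ 2)
      = ∑ i, (A (b i) (b i) * A v v - A (b i) v ^ 2) := by
    intro v
    have := sum_bilin_orthonormalBasis
      (A v v • A - (LinearMap.lsmul ℝ ℝ).compl₁₂ (A.flip v) (A.flip v)) e b
    simpa [pow_two, mul_comm] using this
  rw [gaussBiRic, gaussBiRic, h x, h y]

theorem exists_orthonormalBasis_pair {n : ℕ} (hn : 2 ≤ n) [FiniteDimensional ℝ V]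
    (hV : Module.finrank ℝ V = n) {x y : V} (hx : ‖x‖ = 1) (hy : ‖y‖ = 1)
    (hxy : inner ℝ x y = 0) :
    ∃ b : OrthonormalBasis (Fin n) ℝ V, b ⟨0, by omega⟩ = x ∧ b ⟨1, by omega⟩ = y := by
  let v : Fin n → V := fun i => if i.val = 0 then x else y
  let s : Set (Fin n) := {⟨0, by omega⟩, ⟨1, by omega⟩}
  have hv : Orthonormal ℝ (s.domRestrict v) := by
    rw [orthonormal_iff_ite]
    rintro ⟨i, hi⟩ ⟨j, hj⟩
    have hyx : inner ℝ y x = 0 := by rw [real_inner_comm]; exact hxy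
    rcases hi with rfl | rfl <;> rcases hj with rfl | rfl <;>
      simp [v, Set.domRestrict_apply, hx, hy, hxy, hyx, Subtype.ext_iff]
  obtain ⟨b, hb⟩ := hv.exists_orthonormalBasis_extension_of_card_eq (by simpa using hV)
  refine ⟨b, ?_, ?_⟩
  · rw [hb _ (by simp [s])]; simp [v]
  · rw [hb _ (by simp [s])]; simp [v]

/-- Up to the small term on the left, the form is ½[(u+v)² + (u+z)² + (v+z)²], that is, ½[(u+v+z)² +
u² + v² + z²]. -/
theorem diagonal_bound_three (u v z : ℝ) :
    1 / 100 * (u + v + z) ^ 2 ≤ (u ^ 2 + v ^ 2 + z ^ 2) + ((u + v + z) * u - u ^ 2)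
      + ((u + v + z) * v - v ^ 2) - u * v := by
  nlinarith [sq_nonneg (u - v), sq_nonneg (u + v + z), sq_nonneg (u + v), sq_nonneg z,
    sq_nonneg (u + v - z)]

/-- With p = u+v and q = z+w, the right side is at least 0.8p² + pq + 0.55q², which is positive
definite; the differences u-v and z-w enter only through squares. -/
theorem diagonal_bound_four (u v z w : ℝ) :
    1 / 100 * (u + v + z + w) ^ 2 ≤ 11 / 10 * (u ^ 2 + v ^ 2 + z ^ 2 + w ^ 2)
      + ((u + v + z + w) * u - u ^ 2) + ((u + v + z + w) * v - v ^ 2) - u * v := by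
  nlinarith [sq_nonneg (u - v), sq_nonneg (u + v + z + w), sq_nonneg (z - w),
    sq_nonneg (u + v + (z + w) * (4 / 5)), sq_nonneg (u + v), sq_nonneg (z + w)]

theorem diagonal_bound_five (u v z w t : ℝ) :
    1 / 1000 * (u + v + z + w + t) ^ 2 ≤
      111 / 100 * (u ^ 2 + v ^ 2 + z ^ 2 + w ^ 2 + t ^ 2)
      + ((u + v + z + w + t) * u - u ^ 2)
      + 93 / 100 * ((u + v + z + w + t) * v - v ^ 2) - 93 / 100 * (u * v) := by
  -- Cauchy–Schwarz reduces to three variables, with coefficient 37/100 = (111/100)/3 for Z².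
  have h : (z + w + t) ^ 2 ≤ 3 * (z ^ 2 + w ^ 2 + t ^ 2) := by
    nlinarith [sq_nonneg (z - w), sq_nonneg (w - t), sq_nonneg (z - t)]
  obtain ⟨Z, hZ⟩ : ∃ Z, Z = z + w + t := ⟨_, rfl⟩
  have key : 1 / 1000 * (u + v + Z) ^ 2 ≤ 111 / 100 * (u ^ 2 + v ^ 2) + 37 / 100 * Z ^ 2
      + ((u + v + Z) * u - u ^ 2) + 93 / 100 * ((u + v + Z) * v - v ^ 2)
      - 93 / 100 * (u * v) := by
    -- After subtracting (u+v+Z)²/1000, the coefficient of u² is 1109/1000 and those of uv and uZ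
    -- are 2·499/1000, so the first square eliminates u. The ratio 27/100 approximately completes
    -- the square in v.
    nlinarith [sq_nonneg (u + v * (500 - 1) / 1109 + Z * (500 - 1) / 1109),
      sq_nonneg (v + Z * 27 / 100), sq_nonneg Z, sq_nonneg v]
  rw [hZ] at key
  nlinarith

/-- The algebraic inequality behind the lower bound for the `α`-biRic curvature. -/
theorem gaussBiRic_lower_bound {n : ℕ} (hn3 : 3 ≤ n) (hn5 : n ≤ 5) [FiniteDimensional ℝ V]
    (hV : Module.finrank ℝ V = n) {ι : Type*} [Fintype ι] (A : V →ₗ[ℝ] V →ₗ[ℝ] ℝ)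
    (hA : ∀ v w, A v w = A w v) (e : OrthonormalBasis ι ℝ V) {x y : V}
    (hx : ‖x‖ = 1) (hy : ‖y‖ = 1) (hxy : inner ℝ x y = 0) :
    1 / 1000 * (∑ i, A (e i) (e i)) ^ 2 ≤
      aConst n * ∑ i, ∑ j, A (e i) (e j) ^ 2 + gaussBiRic (alphaConst n) A e x y := by
  obtain ⟨b, rfl, rfl⟩ := exists_orthonormalBasis_pair (by omega) hV hx hy hxy
  rw [sum_bilin_orthonormalBasis A e b, sum_sq_bilin_orthonormalBasis A e b,
    gaussBiRic_eq _ A e b]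
  unfold gaussBiRic
  -- The diagonal entries are handled by the three bounds above. The off-diagonal squares have
  -- coefficient 2a-1 when the index of x is involved, 2a-α for that of y without x, and 2a
  -- otherwise; all are positive.
  have hn : n = 3 ∨ n = 4 ∨ n = 5 := by omega
  rcases hn with rfl | rfl | rfl
  · simp only [Fin.sum_univ_three, aConst, alphaConst, Fin.mk_zero', Fin.mk_one]
    norm_num
    have := diagonal_bound_three (A (b 0) (b 0)) (A (b 1) (b 1)) (A (b 2) (b 2))
    rw [hA (b 1) (b 0), hA (b 2) (b 0), hA (b 2) (b 1)]
    nlinarith [sq_nonneg (A (b 0) (b 1)), sq_nonneg (A (b 0) (b 2)), sq_nonneg (A (b 1) (b 2)),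
      sq_nonneg (A (b 0) (b 0) + A (b 1) (b 1) + A (b 2) (b 2))]
  · simp only [Fin.sum_univ_four, aConst, alphaConst, Fin.mk_zero', Fin.mk_one]
    norm_num
    have := diagonal_bound_four (A (b 0) (b 0)) (A (b 1) (b 1)) (A (b 2) (b 2)) (A (b 3) (b 3))
    rw [hA (b 1) (b 0), hA (b 2) (b 0), hA (b 2) (b 1), hA (b 3) (b 0), hA (b 3) (b 1),
      hA (b 3) (b 2)]
    nlinarith [sq_nonneg (A (b 0) (b 1)), sq_nonneg (A (b 0) (b 2)), sq_nonneg (A (b 1) (b 2)),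
      sq_nonneg (A (b 0) (b 3)), sq_nonneg (A (b 1) (b 3)), sq_nonneg (A (b 2) (b 3)),
      sq_nonneg (A (b 0) (b 0) + A (b 1) (b 1) + A (b 2) (b 2) + A (b 3) (b 3))]
  · simp only [Fin.sum_univ_five, aConst, alphaConst, Fin.mk_zero', Fin.mk_one]
    norm_num
    have := diagonal_bound_five (A (b 0) (b 0)) (A (b 1) (b 1)) (A (b 2) (b 2)) (A (b 3) (b 3))
      (A (b 4) (b 4))
    rw [hA (b 1) (b 0), hA (b 2) (b 0), hA (b 2) (b 1), hA (b 3) (b 0), hA (b 3) (b 1),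
      hA (b 3) (b 2), hA (b 4) (b 0), hA (b 4) (b 1), hA (b 4) (b 2), hA (b 4) (b 3)]
    nlinarith [sq_nonneg (A (b 0) (b 1)), sq_nonneg (A (b 0) (b 2)), sq_nonneg (A (b 1) (b 2)),
      sq_nonneg (A (b 0) (b 3)), sq_nonneg (A (b 1) (b 3)), sq_nonneg (A (b 2) (b 3)),
      sq_nonneg (A (b 0) (b 4)), sq_nonneg (A (b 1) (b 4)), sq_nonneg (A (b 2) (b 4)),
      sq_nonneg (A (b 3) (b 4))]

end LinearAlgebra
end CMC

/-! ### The Gauss equation for a parametrized submanifold. -/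

namespace CMC
section EuclideanGauss

variable {n : ℕ}

/-- The Christoffel symbols of a metric `γ` given in coordinates. -/
noncomputable def christoffelOf (γ : EuclideanSpace ℝ (Fin n) → Matrix (Fin n) (Fin n) ℝ)
    (k i j : Fin n) (y : EuclideanSpace ℝ (Fin n)) : ℝ :=
  (1 / 2) * ∑ l, (γ y)⁻¹ k l *
    (partialDeriv n i (fun z => γ z j l) y + partialDeriv n j (fun z => γ z i l) y
      - partialDeriv n l (fun z => γ z i j) y)

/-- The curvature components of a metric `γ` given in coordinates. -/
noncomputable def curvatureOf (γ : EuclideanSpace ℝ (Fin n) → Matrix (Fin n) (Fin n) ℝ)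
    (y : EuclideanSpace ℝ (Fin n)) (i j k l : Fin n) : ℝ :=
  partialDeriv n i (christoffelOf γ l j k) y - partialDeriv n j (christoffelOf γ l i k) y
    + ∑ m, (christoffelOf γ l i m y * christoffelOf γ m j k y
      - christoffelOf γ l j m y * christoffelOf γ m i k y)

theorem partialDeriv_congr {f g : EuclideanSpace ℝ (Fin n) → ℝ} {y : EuclideanSpace ℝ (Fin n)}
    (h : f =ᶠ[nhds y] g) (i : Fin n) : partialDeriv n i f y = partialDeriv n i g y := by
  rw [partialDeriv, partialDeriv, h.fderiv_eq]

theorem christoffelOf_congr {γ γ' : EuclideanSpace ℝ (Fin n) → Matrix (Fin n) (Fin n) ℝ}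
    {y : EuclideanSpace ℝ (Fin n)} (h : γ =ᶠ[nhds y] γ') (k i j : Fin n) :
    christoffelOf γ k i j =ᶠ[nhds y] christoffelOf γ' k i j := by
  filter_upwards [h.eventuallyEq_nhds] with z hz
  have h2 : ∀ a b, (fun w => γ w a b) =ᶠ[nhds z] fun w => γ' w a b := fun a b =>
    hz.mono fun w hw => by simp only [hw]
  simp only [christoffelOf, hz.eq_of_nhds]
  congr 1
  refine Finset.sum_congr rfl fun l _ => ?_
  rw [partialDeriv_congr (h2 j l), partialDeriv_congr (h2 i l), partialDeriv_congr (h2 i j)]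

/-- Curvature depends only on the germ of the metric. This is needed because `chartMetric` is
identified with a Gram matrix only on the chart's target. -/
theorem curvatureOf_congr {γ γ' : EuclideanSpace ℝ (Fin n) → Matrix (Fin n) (Fin n) ℝ}
    {y : EuclideanSpace ℝ (Fin n)} (h : γ =ᶠ[nhds y] γ') (i j k l : Fin n) :
    curvatureOf γ y i j k l = curvatureOf γ' y i j k l := by
  have h2 := fun a b c => christoffelOf_congr h a b c
  simp only [curvatureOf, partialDeriv_congr (h2 _ _ _), (h2 _ _ _).eq_of_nhds]

variable {W : Type*} [NormedAddCommGroup W] [InnerProductSpace ℝ W]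

/-- The first fundamental form of a parametrized submanifold. -/
noncomputable def gram (G : EuclideanSpace ℝ (Fin n) → W) (y : EuclideanSpace ℝ (Fin n)) :
    Matrix (Fin n) (Fin n) ℝ :=
  Matrix.of fun i j => inner ℝ (fderiv ℝ G y (EuclideanSpace.single i 1))
    (fderiv ℝ G y (EuclideanSpace.single j 1))

theorem gram_comm (G : EuclideanSpace ℝ (Fin n) → W) (y : EuclideanSpace ℝ (Fin n))
    (i j : Fin n) : gram G y i j = gram G y j i := by
  simp only [gram, Matrix.of_apply]; exact real_inner_comm _ _

theorem euclidean_eq_sum_single (v : EuclideanSpace ℝ (Fin n)) :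
    v = ∑ i, v i • EuclideanSpace.single i (1 : ℝ) := by
  ext j; simp [Pi.single_apply]

/-- For v in the kernel of the Gram matrix, |DG(v)|² = vᵀgv = 0. -/
theorem gram_det_ne_zero {G : EuclideanSpace ℝ (Fin n) → W} {y : EuclideanSpace ℝ (Fin n)}
    (h : Function.Injective (fderiv ℝ G y)) : (gram G y).det ≠ 0 := by
  intro h0
  obtain ⟨v, hv, hv0⟩ := Matrix.exists_mulVec_eq_zero_iff.mpr h0
  apply hv
  have h1 : inner ℝ (∑ i, v i • fderiv ℝ G y (EuclideanSpace.single i 1))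
      (∑ i, v i • fderiv ℝ G y (EuclideanSpace.single i 1)) = (0 : ℝ) := by
    have h2 : ∀ i, ∑ j, gram G y i j * v j = 0 := fun i => congrFun hv0 i
    simp only [sum_inner, inner_sum, inner_smul_left, inner_smul_right, conj_trivial]
    refine Finset.sum_eq_zero fun i _ => ?_
    rw [← mul_zero (v i), ← h2 i]
    congr 1
    refine Finset.sum_congr rfl fun j _ => ?_
    rw [gram_comm, mul_comm]
    rfl
  rw [inner_self_eq_zero] at h1
  have h3 : fderiv ℝ G y (WithLp.toLp 2 v) = fderiv ℝ G y 0 := by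
    rw [euclidean_eq_sum_single (WithLp.toLp 2 v), map_sum, map_zero, ← h1]
    simp only [map_smul]
  have h4 := h h3
  ext i
  exact congrArg (fun w : EuclideanSpace ℝ (Fin n) => w i) h4

theorem two_le_infty : (2 : WithTop ℕ∞) ≤ ∞ := ENat.LEInfty.out

theorem contDiffAt_fderiv {X Y : Type*} [NormedAddCommGroup X] [NormedSpace ℝ X]
    [NormedAddCommGroup Y] [NormedSpace ℝ Y] {G : X → Y} {y : X} (hG : ContDiffAt ℝ ∞ G y) :
    ContDiffAt ℝ ∞ (fderiv ℝ G) y :=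
  hG.fderiv_right (m := ∞) (by simp)

theorem fderiv_fderiv_comm {X Y : Type*} [NormedAddCommGroup X] [NormedSpace ℝ X]
    [NormedAddCommGroup Y] [NormedSpace ℝ Y] {G : X → Y} {y : X} (hG : ContDiffAt ℝ ∞ G y)
    (v w : X) : fderiv ℝ (fderiv ℝ G) y v w = fderiv ℝ (fderiv ℝ G) y w v :=
  (hG.isSymmSndFDerivAt (by simpa using two_le_infty)).eq v w

theorem hasFDerivAt_fderiv_apply {X Y : Type*} [NormedAddCommGroup X] [NormedSpace ℝ X]
    [NormedAddCommGroup Y] [NormedSpace ℝ Y] {G : X → Y} {y : X} (hG : ContDiffAt ℝ ∞ G y)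
    (v : X) : HasFDerivAt (fun z => fderiv ℝ G z v) ((fderiv ℝ (fderiv ℝ G) y).flip v) y := by
  have := ((contDiffAt_fderiv hG).differentiableAt (by simp)).hasFDerivAt.clm_apply
    (hasFDerivAt_const v y)
  simpa using this

theorem partialDeriv_gram {G : EuclideanSpace ℝ (Fin n) → W} {y : EuclideanSpace ℝ (Fin n)}
    (hG : ContDiffAt ℝ ∞ G y) (i j k : Fin n) :
    partialDeriv n i (fun z => gram G z j k) y =
      inner ℝ (fderiv ℝ (fderiv ℝ G) y (EuclideanSpace.single i 1) (EuclideanSpace.single j 1))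
        (fderiv ℝ G y (EuclideanSpace.single k 1)) +
      inner ℝ (fderiv ℝ G y (EuclideanSpace.single j 1))
        (fderiv ℝ (fderiv ℝ G) y (EuclideanSpace.single i 1) (EuclideanSpace.single k 1)) := by
  have h2 := (hasFDerivAt_fderiv_apply hG (EuclideanSpace.single j 1)).inner ℝ
    (hasFDerivAt_fderiv_apply hG (EuclideanSpace.single k 1))
  rw [partialDeriv]
  simp only [gram, Matrix.of_apply]
  rw [h2.fderiv]
  simp
  ring

/-- Each ∂g is a sum of two terms ⟨∂²G, ∂G⟩; by symmetry of second derivatives all but two equal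
ones cancel in the Koszul combination. -/
theorem christoffelOf_gram {G : EuclideanSpace ℝ (Fin n) → W}
    {y : EuclideanSpace ℝ (Fin n)} (hG : ContDiffAt ℝ ∞ G y) (k i j : Fin n) :
    christoffelOf (gram G) k i j y = ∑ l, (gram G y)⁻¹ k l *
      inner ℝ (fderiv ℝ (fderiv ℝ G) y (EuclideanSpace.single i 1) (EuclideanSpace.single j 1))
        (fderiv ℝ G y (EuclideanSpace.single l 1)) := by
  rw [christoffelOf, Finset.mul_sum]
  refine Finset.sum_congr rfl fun l _ => ?_
  simp only [partialDeriv_gram hG]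
  rw [fderiv_fderiv_comm hG (EuclideanSpace.single j 1) (EuclideanSpace.single i 1),
    fderiv_fderiv_comm hG (EuclideanSpace.single l 1) (EuclideanSpace.single i 1),
    fderiv_fderiv_comm hG (EuclideanSpace.single l 1) (EuclideanSpace.single j 1),
    real_inner_comm (fderiv ℝ G y (EuclideanSpace.single j 1))]
  ring

/-- The tangential part of ∂ᵢ∂ⱼG is ∑ₖ Γᵏᵢⱼ ∂ₖG. In this form the inverse metric no longer appears,
so differentiating it avoids the derivative of g⁻¹. -/
theorem sum_christoffelOf_mul_gram {G : EuclideanSpace ℝ (Fin n) → W}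
    {y : EuclideanSpace ℝ (Fin n)} (hG : ContDiffAt ℝ ∞ G y)
    (hinj : Function.Injective (fderiv ℝ G y)) (i j m : Fin n) :
    ∑ k, christoffelOf (gram G) k i j y * gram G y k m =
      inner ℝ (fderiv ℝ (fderiv ℝ G) y (EuclideanSpace.single i 1) (EuclideanSpace.single j 1))
        (fderiv ℝ G y (EuclideanSpace.single m 1)) := by
  have hdet : IsUnit (gram G y).det := (gram_det_ne_zero hinj).isUnit
  simp only [christoffelOf_gram hG, Finset.sum_mul]
  rw [Finset.sum_comm]
  have h : ∀ l, ∑ k, gram G y m k * (gram G y)⁻¹ k l = (1 : Matrix (Fin n) (Fin n) ℝ) m l := by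
    intro l
    rw [← Matrix.mul_nonsing_inv _ hdet, Matrix.mul_apply]
  calc _ = ∑ l, (∑ k, gram G y m k * (gram G y)⁻¹ k l) *
        inner ℝ (fderiv ℝ (fderiv ℝ G) y (EuclideanSpace.single i 1) (EuclideanSpace.single j 1))
          (fderiv ℝ G y (EuclideanSpace.single l 1)) := by
        refine Finset.sum_congr rfl fun l _ => ?_
        rw [Finset.sum_mul]
        refine Finset.sum_congr rfl fun k _ => ?_
        rw [gram_comm G y k m]
        ring
    _ = _ := by simp [h, Matrix.one_apply]

/-- Cramer's rule: the entries of the inverse are polynomials in the entries divided by the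
determinant. -/
theorem differentiableAt_matrix_inv {X : Type*} [NormedAddCommGroup X] [NormedSpace ℝ X]
    {γ : X → Matrix (Fin n) (Fin n) ℝ} {y : X}
    (h : ∀ i j, DifferentiableAt ℝ (fun z => γ z i j) y) (hdet : (γ y).det ≠ 0) (i j : Fin n) :
    DifferentiableAt ℝ (fun z => (γ z)⁻¹ i j) y := by
  have hd : ∀ δ : X → Matrix (Fin n) (Fin n) ℝ, (∀ i j, DifferentiableAt ℝ (fun z => δ z i j) y) →
      DifferentiableAt ℝ (fun z => (δ z).det) y := by
    intro δ hδ
    simp only [Matrix.det_apply']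
    fun_prop
  simp only [Matrix.inv_def, Matrix.smul_apply, Ring.inverse_eq_inv', smul_eq_mul,
    Matrix.adjugate_apply]
  refine ((hd γ h).inv hdet).mul (hd _ fun a b => ?_)
  by_cases hab : a = j
  · subst hab; simp
  · simpa [Matrix.updateRow_ne hab] using h a b

theorem differentiableAt_christoffelOf_gram {G : EuclideanSpace ℝ (Fin n) → W}
    {y : EuclideanSpace ℝ (Fin n)} (hG : ∀ᶠ z in nhds y, ContDiffAt ℝ ∞ G z)
    (hinj : Function.Injective (fderiv ℝ G y)) (k i j : Fin n) :
    DifferentiableAt ℝ (christoffelOf (gram G) k i j) y := by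
  have hGy := hG.self_of_nhds
  have h1 : christoffelOf (gram G) k i j =ᶠ[nhds y] fun z => ∑ l, (gram G z)⁻¹ k l *
      inner ℝ (fderiv ℝ (fderiv ℝ G) z (EuclideanSpace.single i 1) (EuclideanSpace.single j 1))
        (fderiv ℝ G z (EuclideanSpace.single l 1)) :=
    hG.mono fun z hz => christoffelOf_gram hz k i j
  refine DifferentiableAt.congr_of_eventuallyEq ?_ h1
  have h2 : ∀ a : Fin n,
      DifferentiableAt ℝ (fun z => fderiv ℝ G z (EuclideanSpace.single a 1)) y :=
    fun a => (hasFDerivAt_fderiv_apply hGy _).differentiableAt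
  have h3 : DifferentiableAt ℝ (fun z => fderiv ℝ (fderiv ℝ G) z (EuclideanSpace.single i 1)
      (EuclideanSpace.single j 1)) y :=
    (((contDiffAt_fderiv (contDiffAt_fderiv hGy)).differentiableAt (by simp)).clm_apply
      (differentiableAt_const _)).clm_apply (differentiableAt_const _)
  have h4 : ∀ a b, DifferentiableAt ℝ (fun z => (gram G z)⁻¹ a b) y :=
    differentiableAt_matrix_inv (fun a b => by
      simp only [gram, Matrix.of_apply]
      exact (h2 a).inner ℝ (h2 b)) (gram_det_ne_zero hinj)
  exact DifferentiableAt.fun_sum fun l _ => (h4 k l).mul (h3.inner ℝ (h2 l))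

/-- The derivative of the identity `∑ₗ Γˡⱼₖ gₗₘ = ⟨∂ⱼₖ G, ∂ₘ G⟩`. -/
theorem sum_partialDeriv_christoffelOf_mul_gram {G : EuclideanSpace ℝ (Fin n) → W}
    {y : EuclideanSpace ℝ (Fin n)}
    (h : ∀ᶠ z in nhds y, ContDiffAt ℝ ∞ G z ∧ Function.Injective (fderiv ℝ G z))
    (i j k m : Fin n) :
    ∑ l, partialDeriv n i (christoffelOf (gram G) l j k) y * gram G y l m =
      inner ℝ (fderiv ℝ (fderiv ℝ (fderiv ℝ G)) y (EuclideanSpace.single i 1)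
        (EuclideanSpace.single j 1) (EuclideanSpace.single k 1))
        (fderiv ℝ G y (EuclideanSpace.single m 1)) +
      inner ℝ (fderiv ℝ (fderiv ℝ G) y (EuclideanSpace.single j 1) (EuclideanSpace.single k 1))
        (fderiv ℝ (fderiv ℝ G) y (EuclideanSpace.single i 1) (EuclideanSpace.single m 1)) -
      ∑ l, christoffelOf (gram G) l j k y *
        (inner ℝ (fderiv ℝ (fderiv ℝ G) y (EuclideanSpace.single i 1)
            (EuclideanSpace.single l 1)) (fderiv ℝ G y (EuclideanSpace.single m 1)) +
          inner ℝ (fderiv ℝ G y (EuclideanSpace.single l 1))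
            (fderiv ℝ (fderiv ℝ G) y (EuclideanSpace.single i 1)
              (EuclideanSpace.single m 1))) := by
  obtain ⟨hGy, hinj⟩ := h.self_of_nhds
  have hev : (fun z => ∑ l, christoffelOf (gram G) l j k z * gram G z l m) =ᶠ[nhds y] fun z =>
      inner ℝ (fderiv ℝ (fderiv ℝ G) z (EuclideanSpace.single j 1) (EuclideanSpace.single k 1))
        (fderiv ℝ G z (EuclideanSpace.single m 1)) :=
    h.mono fun z hz => sum_christoffelOf_mul_gram hz.1 hz.2 j k m
  have hgd : ∀ a b, DifferentiableAt ℝ (fun z => gram G z a b) y := fun a b => by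
    simp only [gram, Matrix.of_apply]
    exact (hasFDerivAt_fderiv_apply hGy _).differentiableAt.inner ℝ
      (hasFDerivAt_fderiv_apply hGy _).differentiableAt
  have hL := HasFDerivAt.fun_sum (u := Finset.univ) fun l (_ : l ∈ Finset.univ) =>
    (differentiableAt_christoffelOf_gram (h.mono fun z hz => hz.1) hinj
      l j k).hasFDerivAt.mul (hgd l m).hasFDerivAt
  have h3 : HasFDerivAt (fun z => fderiv ℝ (fderiv ℝ G) z (EuclideanSpace.single j 1)
      (EuclideanSpace.single k 1))
      (((fderiv ℝ (fderiv ℝ (fderiv ℝ G)) y).flip (EuclideanSpace.single j 1)).flip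
        (EuclideanSpace.single k 1)) y := by
    have := (hasFDerivAt_fderiv_apply (contDiffAt_fderiv hGy)
      (EuclideanSpace.single j 1)).clm_apply (hasFDerivAt_const (EuclideanSpace.single k (1 : ℝ)) y)
    simpa using this
  have hR := h3.inner ℝ (hasFDerivAt_fderiv_apply hGy (EuclideanSpace.single m 1))
  have hD : ∀ l, partialDeriv n i (fun z => gram G z l m) y = _ :=
    fun l => partialDeriv_gram hGy i l m
  have heq := congrArg (fun T : EuclideanSpace ℝ (Fin n) →L[ℝ] ℝ => T (EuclideanSpace.single i 1))
    (hL.fderiv.symm.trans (hev.fderiv_eq.trans hR.fderiv))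
  simp only [_root_.sum_apply, _root_.add_apply,
    _root_.smul_apply, smul_eq_mul, Finset.sum_add_distrib] at heq
  simp only [← hD]
  rw [eq_sub_iff_add_eq, add_comm (∑ l, _)]
  simp only [partialDeriv]
  convert heq using 1
  · congr 1
    exact Finset.sum_congr rfl fun l _ => mul_comm _ _
  · simp [add_comm]

/-- The Gauss equation for a submanifold given by a local parametrization. -/
theorem gauss_equation_of_parametrization [CompleteSpace W]
    {G : EuclideanSpace ℝ (Fin n) → W}
    {y : EuclideanSpace ℝ (Fin n)}
    (h : ∀ᶠ z in nhds y, ContDiffAt ℝ ∞ G z ∧ Function.Injective (fderiv ℝ G z))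
    {S : Submodule ℝ W}
    (hS : S = LinearMap.range (fderiv ℝ G y).toLinearMap) (i j k m : Fin n) :
    ∑ l, curvatureOf (gram G) y i j k l * gram G y l m =
      inner ℝ (Sᗮ.starProjection (fderiv ℝ (fderiv ℝ G) y (EuclideanSpace.single j 1)
          (EuclideanSpace.single k 1)))
        (Sᗮ.starProjection (fderiv ℝ (fderiv ℝ G) y (EuclideanSpace.single i 1)
          (EuclideanSpace.single m 1))) -
      inner ℝ (Sᗮ.starProjection (fderiv ℝ (fderiv ℝ G) y (EuclideanSpace.single i 1)
          (EuclideanSpace.single k 1)))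
        (Sᗮ.starProjection (fderiv ℝ (fderiv ℝ G) y (EuclideanSpace.single j 1)
          (EuclideanSpace.single m 1))) := by
  obtain ⟨hG, hinj⟩ := h.self_of_nhds
  set D : Fin n → W := fun a => fderiv ℝ G y (EuclideanSpace.single a 1) with hD
  set D2 : Fin n → Fin n → W := fun a b => fderiv ℝ (fderiv ℝ G) y (EuclideanSpace.single a 1)
    (EuclideanSpace.single b 1) with hD2
  set Γ : Fin n → Fin n → Fin n → ℝ := fun a b c => christoffelOf (gram G) a b c y with hΓ
  have hc : ∀ a b c, ∑ l, Γ l a b * gram G y l c = inner ℝ (D2 a b) (D c) :=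
    fun a b c => sum_christoffelOf_mul_gram hG hinj a b c
  have hDS : ∀ a, D a ∈ S := fun a => by rw [hS]; exact ⟨_, rfl⟩
  -- Gauss formula: removing the Christoffel combination of the ∂ₗG leaves exactly the normal part.
  have hproj : ∀ a b, Sᗮ.starProjection (D2 a b) = D2 a b - ∑ l, Γ l a b • D l := by
    intro a b
    refine Submodule.eq_starProjection_of_mem_of_inner_eq_zero ?_ ?_
    · rw [Submodule.mem_orthogonal]
      intro u hu
      rw [hS] at hu
      obtain ⟨v, rfl⟩ := hu
      have : ∀ c, inner ℝ (D c) (D2 a b - ∑ l, Γ l a b • D l) = (0 : ℝ) := by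
        intro c
        rw [inner_sub_right, inner_sum, real_inner_comm, ← hc a b c, sub_eq_zero]
        refine Finset.sum_congr rfl fun l _ => ?_
        rw [inner_smul_right, gram_comm]
        rfl
      rw [euclidean_eq_sum_single v]
      simp only [ContinuousLinearMap.coe_coe, map_sum, map_smul, sum_inner, inner_smul_left]
      exact Finset.sum_eq_zero fun c _ => by rw [this c, mul_zero]
    · intro w hw
      rw [sub_sub_cancel]
      exact hw _ (Submodule.sum_mem _ fun l _ => Submodule.smul_mem _ _ (hDS l))
  have hN : ∀ a b c d, inner ℝ (Sᗮ.starProjection (D2 a b)) (Sᗮ.starProjection (D2 c d)) =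
      inner ℝ (D2 a b) (D2 c d) - ∑ l, Γ l a b * inner ℝ (D l) (D2 c d) := by
    intro a b c d
    rw [← Submodule.inner_starProjection_left_eq_right,
      Submodule.starProjection_eq_self_iff.mpr (Submodule.starProjection_apply_mem _ _), hproj, inner_sub_left, sum_inner]
    simp [inner_smul_left]
  have h1 := sum_partialDeriv_christoffelOf_mul_gram h i j k m
  have h2 := sum_partialDeriv_christoffelOf_mul_gram h j i k m
  -- Symmetry of the third derivative in its first two slots makes it cancel when the two identities
  -- are subtracted.
  rw [fderiv_fderiv_comm (contDiffAt_fderiv hG) (EuclideanSpace.single j 1)] at h2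
  have h3 : ∀ a b, ∑ l, (∑ p, Γ l a p * Γ p b k) * gram G y l m =
      ∑ p, Γ p b k * inner ℝ (D2 a p) (D m) := by
    intro a b
    simp only [← hc, Finset.sum_mul, Finset.mul_sum]
    rw [Finset.sum_comm]
    exact Finset.sum_congr rfl fun p _ => Finset.sum_congr rfl fun l _ => by ring
  change _ = inner ℝ (Sᗮ.starProjection (D2 j k)) (Sᗮ.starProjection (D2 i m)) -
    inner ℝ (Sᗮ.starProjection (D2 i k)) (Sᗮ.starProjection (D2 j m))
  have h4 := h3 i j
  have h5 := h3 j i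
  rw [hN, hN]
  simp only [curvatureOf, Finset.sum_sub_distrib, add_mul, sub_mul, Finset.sum_add_distrib,
    mul_add] at h1 h2 ⊢
  linarith

/-- Under a change of chart τ, the failure of D²G to be tensorial is DG(D²τ), a tangent vector,
which the normal projection kills. -/
theorem fderiv_fderiv_comp {X Y Z : Type*} [NormedAddCommGroup X] [NormedSpace ℝ X]
    [NormedAddCommGroup Y] [NormedSpace ℝ Y] [NormedAddCommGroup Z] [NormedSpace ℝ Z]
    {G : Y → Z} {τ : X → Y} {y : X} (hG : ContDiffAt ℝ ∞ G (τ y)) (hτ : ContDiffAt ℝ ∞ τ y)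
    (a b : X) :
    fderiv ℝ (fderiv ℝ (G ∘ τ)) y a b =
      fderiv ℝ (fderiv ℝ G) (τ y) (fderiv ℝ τ y a) (fderiv ℝ τ y b) +
        fderiv ℝ G (τ y) (fderiv ℝ (fderiv ℝ τ) y a b) := by
  have hG1 := (hG.of_le two_le_infty).eventually (by simp)
  have hτ1 := (hτ.of_le two_le_infty).eventually (by simp)
  have hev : fderiv ℝ (G ∘ τ) =ᶠ[nhds y] fun z => (fderiv ℝ G (τ z)).comp (fderiv ℝ τ z) := by
    filter_upwards [hτ.continuousAt.eventually hG1, hτ1] with z h1 h2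
    exact fderiv_comp z (h1.differentiableAt (by simp)) (h2.differentiableAt (by simp))
  have h1 : HasFDerivAt (fun z => fderiv ℝ G (τ z))
      ((fderiv ℝ (fderiv ℝ G) (τ y)).comp (fderiv ℝ τ y)) y :=
    ((contDiffAt_fderiv hG).differentiableAt (by simp)).hasFDerivAt.comp y
      (hτ.differentiableAt (by simp)).hasFDerivAt
  have h2 := h1.clm_comp ((contDiffAt_fderiv hτ).differentiableAt (by simp)).hasFDerivAt
  rw [hev.fderiv_eq, h2.fderiv]
  simp [add_comm]

end EuclideanGauss
end CMC

/-! ### From charts to the hypersurface: metric, second fundamental form, curvature. -/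

namespace CMC
section Charts

variable {n : ℕ} {M : Type*} [TopologicalSpace M] [ChartedSpace (EuclideanSpace ℝ (Fin n)) M]
  [IsManifold (𝓡 n) ∞ M]

/-- The differential at `q` of the chart at `p₀`. -/
noncomputable def chartDeriv (p₀ q : M) : TangentSpace (𝓡 n) q →L[ℝ] EuclideanSpace ℝ (Fin n) :=
  mfderiv (𝓡 n) 𝓘(ℝ, EuclideanSpace ℝ (Fin n)) (extChartAt (𝓡 n) p₀) q

theorem chartDeriv_bijective {p₀ q : M} (hq : q ∈ (extChartAt (𝓡 n) p₀).source) :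
    Function.Bijective (chartDeriv (n := n) p₀ q) := by
  have : IsManifold (𝓡 n) 1 M := IsManifold.of_le (n := ∞) ENat.LEInfty.out
  exact (isInvertible_mfderiv_extChartAt (I := 𝓡 n) hq).bijective

theorem mdifferentiableAt_chart_symm {p₀ : M} {y : EuclideanSpace ℝ (Fin n)}
    (hy : y ∈ (extChartAt (𝓡 n) p₀).target) :
    MDifferentiableAt 𝓘(ℝ, EuclideanSpace ℝ (Fin n)) (𝓡 n) (extChartAt (𝓡 n) p₀).symm y :=
  ((contMDiffOn_extChartAt_symm (n := ∞) p₀).contMDiffAt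
    ((isOpen_extChartAt_target (I := 𝓡 n) p₀).mem_nhds hy)).mdifferentiableAt (by simp)

theorem contDiffAt_comp_chart_symm {W : Type*} [NormedAddCommGroup W] [NormedSpace ℝ W]
    {F : M → W} {m : WithTop ℕ∞} (hm : m ≤ ∞) {p₀ : M}
    {y : EuclideanSpace ℝ (Fin n)} (hy : y ∈ (extChartAt (𝓡 n) p₀).target)
    (hF : ContMDiffAt (𝓡 n) 𝓘(ℝ, W) m F ((extChartAt (𝓡 n) p₀).symm y)) :
    ContDiffAt ℝ m (F ∘ (extChartAt (𝓡 n) p₀).symm) y := by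
  have : IsManifold (𝓡 n) m M := IsManifold.of_le hm
  rw [← contMDiffAt_iff_contDiffAt]
  exact hF.comp y ((contMDiffOn_extChartAt_symm p₀).contMDiffAt
    ((isOpen_extChartAt_target (I := 𝓡 n) p₀).mem_nhds hy))

theorem mfderiv_eq_fderiv_comp_chartDeriv {W : Type*} [NormedAddCommGroup W] [NormedSpace ℝ W]
    {F : M → W} {p₀ q : M} (hF : MDifferentiableAt (𝓡 n) 𝓘(ℝ, W) F q)
    (hq : q ∈ (extChartAt (𝓡 n) p₀).source) (v : TangentSpace (𝓡 n) q) :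
    (mfderiv (𝓡 n) 𝓘(ℝ, W) F q : TangentSpace (𝓡 n) q →L[ℝ] W) v =
      fderiv ℝ (F ∘ (extChartAt (𝓡 n) p₀).symm) (extChartAt (𝓡 n) p₀ q) (chartDeriv p₀ q v) := by
  have : IsManifold (𝓡 n) 1 M := IsManifold.of_le (n := ∞) ENat.LEInfty.out
  have hφ : MDifferentiableAt (𝓡 n) 𝓘(ℝ, EuclideanSpace ℝ (Fin n)) (extChartAt (𝓡 n) p₀) q :=
    mdifferentiableAt_extChartAt (by simpa using hq)
  have hG : MDifferentiableAt 𝓘(ℝ, EuclideanSpace ℝ (Fin n)) 𝓘(ℝ, W)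
      (F ∘ (extChartAt (𝓡 n) p₀).symm) (extChartAt (𝓡 n) p₀ q) := by
    refine MDifferentiableAt.comp (I' := 𝓡 n) _ ?_
      (mdifferentiableAt_chart_symm ((extChartAt (𝓡 n) p₀).map_source hq))
    rwa [(extChartAt (𝓡 n) p₀).left_inv hq]
  have hev : F =ᶠ[nhds q] (F ∘ (extChartAt (𝓡 n) p₀).symm) ∘ extChartAt (𝓡 n) p₀ := by
    filter_upwards [(isOpen_extChartAt_source (I := 𝓡 n) p₀).mem_nhds hq] with z hz
    simp only [Function.comp_apply, (extChartAt (𝓡 n) p₀).left_inv hz]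
  have h := (hG.hasMFDerivAt.comp q hφ.hasMFDerivAt).congr_of_eventuallyEq hev
  rw [h.mfderiv, mfderiv_eq_fderiv]
  rfl

variable [RiemannianBundle (fun x : M => TangentSpace (𝓡 n) x)]
  {F : M → EuclideanSpace ℝ (Fin (n + 1))}

omit [IsManifold (𝓡 n) ∞ M] in
theorem differential_injective (hF : IsIsometricImmersion F) (p : M) :
    Function.Injective (differential F p) := by
  rw [injective_iff_map_eq_zero]
  intro v hv
  have := hF.2 p v v
  rw [hv, inner_zero_left] at this
  exact inner_self_eq_zero.mp this.symm

theorem differential_eq_fderiv (hF : IsIsometricImmersion F) {p₀ q : M}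
    (hq : q ∈ (extChartAt (𝓡 n) p₀).source) (v : TangentSpace (𝓡 n) q) :
    differential F q v = fderiv ℝ (F ∘ (extChartAt (𝓡 n) p₀).symm) (extChartAt (𝓡 n) p₀ q)
      (chartDeriv p₀ q v) :=
  mfderiv_eq_fderiv_comp_chartDeriv (hF.1.mdifferentiableAt (by simp)) hq v

theorem range_differential (hF : IsIsometricImmersion F) {p₀ q : M}
    (hq : q ∈ (extChartAt (𝓡 n) p₀).source) :
    LinearMap.range (differential F q).toLinearMap =
      LinearMap.range (fderiv ℝ (F ∘ (extChartAt (𝓡 n) p₀).symm)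
        (extChartAt (𝓡 n) p₀ q)).toLinearMap := by
  ext w
  constructor
  · rintro ⟨v, rfl⟩
    exact ⟨chartDeriv p₀ q v, (differential_eq_fderiv hF hq v).symm⟩
  · rintro ⟨u, rfl⟩
    obtain ⟨v, rfl⟩ := (chartDeriv_bijective hq).2 u
    exact ⟨v, differential_eq_fderiv hF hq v⟩

theorem fderiv_injective (hF : IsIsometricImmersion F) {p₀ : M}
    {y : EuclideanSpace ℝ (Fin n)} (hy : y ∈ (extChartAt (𝓡 n) p₀).target) :
    Function.Injective (fderiv ℝ (F ∘ (extChartAt (𝓡 n) p₀).symm) y) := by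
  have hq := (extChartAt (𝓡 n) p₀).map_target hy
  rw [injective_iff_map_eq_zero]
  intro u hu
  obtain ⟨v, rfl⟩ := (chartDeriv_bijective hq).2 u
  have h := differential_eq_fderiv hF hq v
  rw [(extChartAt (𝓡 n) p₀).right_inv hy, hu] at h
  rw [(map_eq_zero_iff _ (differential_injective hF _)).mp h, map_zero]

theorem chartMetric_eq_gram (hF : IsIsometricImmersion F) {p₀ : M}
    {y : EuclideanSpace ℝ (Fin n)} (hy : y ∈ (extChartAt (𝓡 n) p₀).target) :
    chartMetric n p₀ y = gram (F ∘ (extChartAt (𝓡 n) p₀).symm) y := by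
  have h : ∀ i, differential F ((extChartAt (𝓡 n) p₀).symm y) (coordVector n p₀ y i) =
      fderiv ℝ (F ∘ (extChartAt (𝓡 n) p₀).symm) y (EuclideanSpace.single i 1) := by
    intro i
    have h := (hF.1.mdifferentiableAt (x := (extChartAt (𝓡 n) p₀).symm y)
      (by simp)).hasMFDerivAt.comp y (mdifferentiableAt_chart_symm hy).hasMFDerivAt
    rw [← mfderiv_eq_fderiv, h.mfderiv]
    rfl
  ext i j
  simp only [chartMetric, gram, Matrix.of_apply]
  rw [← hF.2, h, h]

omit [IsManifold (𝓡 n) ∞ M] [RiemannianBundle (fun x : M => TangentSpace (𝓡 n) x)] in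
theorem secondFundamentalForm_eq (F : M → EuclideanSpace ℝ (Fin (n + 1))) (p : M)
    (v w : TangentSpace (𝓡 n) p) :
    secondFundamentalForm F p v w =
      (LinearMap.range (differential F p).toLinearMap)ᗮ.starProjection
        (fderiv ℝ (fderiv ℝ (F ∘ (extChartAt (𝓡 n) p).symm)) (extChartAt (𝓡 n) p p)
          (chartDeriv p p v) (chartDeriv p p w)) := rfl

/-- The second fundamental form as a bilinear map. -/
noncomputable def secondFundamentalBilin (F : M → EuclideanSpace ℝ (Fin (n + 1))) (p : M) :
    TangentSpace (𝓡 n) p →ₗ[ℝ] TangentSpace (𝓡 n) p →ₗ[ℝ] EuclideanSpace ℝ (Fin (n + 1)) :=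
  LinearMap.mk₂ ℝ (secondFundamentalForm F p)
    (fun v v' w => by simp only [secondFundamentalForm_eq, map_add, _root_.add_apply])
    (fun c v w => by simp only [secondFundamentalForm_eq, map_smul, _root_.smul_apply])
    (fun v w w' => by simp only [secondFundamentalForm_eq, map_add])
    (fun c v w => by simp only [secondFundamentalForm_eq, map_smul])

omit [IsManifold (𝓡 n) ∞ M] [RiemannianBundle (fun x : M => TangentSpace (𝓡 n) x)] in
theorem secondFundamentalBilin_apply (F : M → EuclideanSpace ℝ (Fin (n + 1))) (p : M)
    (v w : TangentSpace (𝓡 n) p) :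
    secondFundamentalBilin F p v w = secondFundamentalForm F p v w := rfl

theorem secondFundamentalForm_comm (hF : IsIsometricImmersion F) (p : M)
    (v w : TangentSpace (𝓡 n) p) :
    secondFundamentalForm F p v w = secondFundamentalForm F p w v := by
  simp only [secondFundamentalForm_eq]
  rw [fderiv_fderiv_comm
    (contDiffAt_comp_chart_symm le_rfl (mem_extChartAt_target (I := 𝓡 n) p) (hF.1 _))]

/-- Both sides are linear in each argument, so the parametrized Gauss equation on coordinate vectors
suffices; the slots are summed out one by one. -/
theorem riemann_eq (hF : IsIsometricImmersion F) (p : M) (x y z w : TangentSpace (𝓡 n) p) :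
    riemann n p x y z w =
      inner ℝ (secondFundamentalForm F p y w) (secondFundamentalForm F p x z) -
      inner ℝ (secondFundamentalForm F p x w) (secondFundamentalForm F p y z) := by
  set G := F ∘ (extChartAt (𝓡 n) p).symm with hG
  set y₀ := extChartAt (𝓡 n) p p with hy₀
  set S := LinearMap.range (differential F p).toLinearMap with hS
  have htgt := (isOpen_extChartAt_target (I := 𝓡 n) p).mem_nhds
    (mem_extChartAt_target (I := 𝓡 n) p)
  have hev : ∀ᶠ u in nhds y₀, ContDiffAt ℝ ∞ G u ∧ Function.Injective (fderiv ℝ G u) := by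
    filter_upwards [htgt] with u hu
    exact ⟨contDiffAt_comp_chart_symm le_rfl hu (hF.1 _), fderiv_injective hF hu⟩
  have hmet : chartMetric n p =ᶠ[nhds y₀] gram G := by
    filter_upwards [htgt] with u hu
    exact chartMetric_eq_gram hF hu
  have hcurv : ∀ i j k l, curvatureCoeff n p i j k l = curvatureOf (gram G) y₀ i j k l :=
    fun i j k l => curvatureOf_congr hmet i j k l
  have hgauss := gauss_equation_of_parametrization hev
    (hS.trans (range_differential hF (mem_extChartAt_source (I := 𝓡 n) p)))
  set B : EuclideanSpace ℝ (Fin n) → EuclideanSpace ℝ (Fin n) → EuclideanSpace ℝ (Fin (n + 1)) :=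
    fun u v => Sᗮ.starProjection (fderiv ℝ (fderiv ℝ G) y₀ u v) with hB
  have hBl : ∀ u v, ∑ i, u i • B (EuclideanSpace.single i 1) v = B u v := by
    intro u v
    conv_rhs => rw [euclidean_eq_sum_single u]
    simp only [hB, map_sum, map_smul, _root_.sum_apply, _root_.smul_apply]
  have hBr : ∀ u v, ∑ i, v i • B u (EuclideanSpace.single i 1) = B u v := by
    intro u v
    conv_rhs => rw [euclidean_eq_sum_single v]
    simp only [hB, map_sum, map_smul]
  change _ = inner ℝ (B (chartDeriv p p y) (chartDeriv p p w))
      (B (chartDeriv p p x) (chartDeriv p p z)) -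
    inner ℝ (B (chartDeriv p p x) (chartDeriv p p w)) (B (chartDeriv p p y) (chartDeriv p p z))
  generalize hX : chartDeriv p p x = X
  generalize hY : chartDeriv p p y = Y
  generalize hZ : chartDeriv p p z = Z
  generalize hW : chartDeriv p p w = V
  have hcoord : riemann n p x y z w = ∑ i, X i * ∑ j, Y j * ∑ k, V k * ∑ m, Z m *
      ∑ l, curvatureOf (gram G) y₀ i j k l * gram G y₀ l m := by
    rw [← hX, ← hY, ← hZ, ← hW]
    simp only [riemann, hcurv, ← hy₀, hmet.eq_of_nhds, Finset.mul_sum]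
    refine Finset.sum_congr rfl fun i _ => Finset.sum_congr rfl fun j _ =>
      Finset.sum_congr rfl fun k _ => ?_
    rw [Finset.sum_comm]
    refine Finset.sum_congr rfl fun m _ => Finset.sum_congr rfl fun l _ => ?_
    simp only [coord, chartDeriv]
    ring
  have hgauss' : ∀ i j k m, ∑ l, curvatureOf (gram G) y₀ i j k l * gram G y₀ l m =
      inner ℝ (B (EuclideanSpace.single j 1) (EuclideanSpace.single k 1))
        (B (EuclideanSpace.single i 1) (EuclideanSpace.single m 1)) -
      inner ℝ (B (EuclideanSpace.single i 1) (EuclideanSpace.single k 1))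
        (B (EuclideanSpace.single j 1) (EuclideanSpace.single m 1)) := hgauss
  have hm : ∀ i j k, ∑ m, Z m * ∑ l, curvatureOf (gram G) y₀ i j k l * gram G y₀ l m =
      inner ℝ (B (EuclideanSpace.single j 1) (EuclideanSpace.single k 1))
        (B (EuclideanSpace.single i 1) Z) -
      inner ℝ (B (EuclideanSpace.single i 1) (EuclideanSpace.single k 1))
        (B (EuclideanSpace.single j 1) Z) := by
    intro i j k
    simp only [hgauss', ← hBr _ Z, inner_sum, inner_smul_right, mul_sub, Finset.sum_sub_distrib]
  have hk : ∀ i j, ∑ k, V k * (inner ℝ (B (EuclideanSpace.single j 1) (EuclideanSpace.single k 1))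
        (B (EuclideanSpace.single i 1) Z) -
      inner ℝ (B (EuclideanSpace.single i 1) (EuclideanSpace.single k 1))
        (B (EuclideanSpace.single j 1) Z)) =
      inner ℝ (B (EuclideanSpace.single j 1) V) (B (EuclideanSpace.single i 1) Z) -
      inner ℝ (B (EuclideanSpace.single i 1) V) (B (EuclideanSpace.single j 1) Z) := by
    intro i j
    simp only [← hBr _ V, sum_inner, real_inner_smul_left, mul_sub, Finset.sum_sub_distrib]
  have hj : ∀ i, ∑ j, Y j * (inner ℝ (B (EuclideanSpace.single j 1) V)
        (B (EuclideanSpace.single i 1) Z) -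
      inner ℝ (B (EuclideanSpace.single i 1) V) (B (EuclideanSpace.single j 1) Z)) =
      inner ℝ (B Y V) (B (EuclideanSpace.single i 1) Z) -
      inner ℝ (B (EuclideanSpace.single i 1) V) (B Y Z) := by
    intro i
    simp only [← hBl Y, sum_inner, inner_sum, real_inner_smul_left, inner_smul_right, mul_sub,
      Finset.sum_sub_distrib]
  rw [hcoord]
  simp only [hm, hk, hj]
  simp only [← hBl X, sum_inner, inner_sum, real_inner_smul_left, inner_smul_right, mul_sub,
      Finset.sum_sub_distrib]

/-- The second fundamental form can be computed in any chart. -/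
theorem secondFundamentalForm_eq_of_chart (hF : IsIsometricImmersion F) {p₀ q : M}
    (hq : q ∈ (extChartAt (𝓡 n) p₀).source) (v w : TangentSpace (𝓡 n) q) :
    secondFundamentalForm F q v w =
      (LinearMap.range (differential F q).toLinearMap)ᗮ.starProjection
        (fderiv ℝ (fderiv ℝ (F ∘ (extChartAt (𝓡 n) p₀).symm)) (extChartAt (𝓡 n) p₀ q)
          (chartDeriv p₀ q v) (chartDeriv p₀ q w)) := by
  have hqq := mem_extChartAt_source (I := 𝓡 n) q
  have hqt := mem_extChartAt_target (I := 𝓡 n) q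
  have hinv := (extChartAt (𝓡 n) q).left_inv hqq
  have hφ : ContMDiffAt (𝓡 n) 𝓘(ℝ, EuclideanSpace ℝ (Fin n)) ∞ (extChartAt (𝓡 n) p₀) q :=
    contMDiffAt_extChartAt' (by simpa using hq)
  set τ := extChartAt (𝓡 n) p₀ ∘ (extChartAt (𝓡 n) q).symm with hτ
  have hτq : τ (extChartAt (𝓡 n) q q) = extChartAt (𝓡 n) p₀ q := by
    simp only [hτ, Function.comp_apply, hinv]
  have hev : F ∘ (extChartAt (𝓡 n) q).symm =ᶠ[nhds (extChartAt (𝓡 n) q q)]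
      (F ∘ (extChartAt (𝓡 n) p₀).symm) ∘ τ := by
    have hc := (continuousAt_extChartAt_symm (I := 𝓡 n) q).eventually
      ((isOpen_extChartAt_source (I := 𝓡 n) p₀).mem_nhds (by rwa [hinv]))
    filter_upwards [hc] with u hu
    simp only [hτ, Function.comp_apply, (extChartAt (𝓡 n) p₀).left_inv hu]
  have hτs : ContDiffAt ℝ ∞ τ (extChartAt (𝓡 n) q q) :=
    contDiffAt_comp_chart_symm le_rfl hqt (by rwa [hinv])
  have hGs : ContDiffAt ℝ ∞ (F ∘ (extChartAt (𝓡 n) p₀).symm) (τ (extChartAt (𝓡 n) q q)) := by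
    rw [hτq]
    exact contDiffAt_comp_chart_symm le_rfl ((extChartAt (𝓡 n) p₀).map_source hq) (hF.1 _)
  have hτ' : ∀ u, fderiv ℝ τ (extChartAt (𝓡 n) q q) (chartDeriv q q u) = chartDeriv p₀ q u :=
    fun u => (mfderiv_eq_fderiv_comp_chartDeriv (hφ.mdifferentiableAt (by simp)) hqq u).symm
  rw [secondFundamentalForm_eq, hev.fderiv.fderiv_eq, fderiv_fderiv_comp hGs hτs, hτ', hτ', map_add,
    hτq, add_eq_left, Submodule.starProjection_apply_eq_zero_iff]
  -- What remains is the correction DG(D²τ), which lies in the range of dF.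
  rw [Submodule.orthogonal_orthogonal, range_differential hF hq]
  exact ⟨_, rfl⟩

end Charts
end CMC

/-! ### Pointwise lower bound for biRic. -/

namespace CMC
section Pointwise

variable {n : ℕ} {M : Type*} [TopologicalSpace M] [ChartedSpace (EuclideanSpace ℝ (Fin n)) M]

theorem finrank_tangentSpace (p : M) : Module.finrank ℝ (TangentSpace (𝓡 n) p) = n := by
  change Module.finrank ℝ (EuclideanSpace ℝ (Fin n)) = n
  simp

variable [RiemannianBundle (fun x : M => TangentSpace (𝓡 n) x)]

theorem exists_orthonormalBasis_of_orthonormal {p : M} {v : Fin n → TangentSpace (𝓡 n) p}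
    (hv : Orthonormal ℝ v) :
    ∃ b : OrthonormalBasis (Fin n) ℝ (TangentSpace (𝓡 n) p), ∀ i, b i = v i := by
  refine ⟨OrthonormalBasis.mk hv (hv.linearIndependent.span_eq_top_of_card_eq_finrank' ?_).ge,
    fun i => by simp⟩
  simp [finrank_tangentSpace]

variable [IsManifold (𝓡 n) ∞ M] {F : M → EuclideanSpace ℝ (Fin (n + 1))}

theorem ricci_eq (hF : IsIsometricImmersion F) {ι : Type*} [Fintype ι] {p : M}
    (e : OrthonormalBasis ι ℝ (TangentSpace (𝓡 n) p)) (x : TangentSpace (𝓡 n) p) :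
    ricci n p x = ∑ i, (inner ℝ (secondFundamentalForm F p x x)
        (secondFundamentalForm F p (e i) (e i)) - ‖secondFundamentalForm F p (e i) x‖ ^ 2) := by
  have h := sum_bilin_orthonormalBasis
    ((secondFundamentalBilin F p).compr₂ (innerₗ _ (secondFundamentalForm F p x x)) -
      (innerₗ (EuclideanSpace ℝ (Fin (n + 1)))).compl₁₂ ((secondFundamentalBilin F p).flip x)
        ((secondFundamentalBilin F p).flip x))
    (stdOrthonormalBasis ℝ (TangentSpace (𝓡 n) p)) e
  simp only [LinearMap.sub_apply, LinearMap.compr₂_apply, LinearMap.compl₁₂_apply,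
    LinearMap.flip_apply, secondFundamentalBilin_apply, innerₗ_apply_apply,
    real_inner_self_eq_norm_sq] at h
  rw [ricci, ← h]
  refine Finset.sum_congr rfl fun i _ => ?_
  rw [riemann_eq hF,
    secondFundamentalForm_comm hF p x (stdOrthonormalBasis ℝ (TangentSpace (𝓡 n) p) i),
    real_inner_self_eq_norm_sq]

theorem biRicOp_eq (hF : IsIsometricImmersion F) {ι : Type*} [Fintype ι] {p : M}
    (e : OrthonormalBasis ι ℝ (TangentSpace (𝓡 n) p)) (α : ℝ) (x y : TangentSpace (𝓡 n) p) :
    biRicOp n α p x y =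
      ∑ i, (inner ℝ (secondFundamentalForm F p x x) (secondFundamentalForm F p (e i) (e i)) -
        ‖secondFundamentalForm F p (e i) x‖ ^ 2) +
      α * ∑ i, (inner ℝ (secondFundamentalForm F p y y) (secondFundamentalForm F p (e i) (e i)) -
        ‖secondFundamentalForm F p (e i) y‖ ^ 2) -
      α * (inner ℝ (secondFundamentalForm F p y y) (secondFundamentalForm F p x x) -
        ‖secondFundamentalForm F p x y‖ ^ 2) := by
  rw [biRicOp, ricci_eq hF e, ricci_eq hF e, riemann_eq hF, secondFundamentalForm_comm hF p y x,
    real_inner_self_eq_norm_sq]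

omit [IsManifold (𝓡 n) ∞ M] in
/-- The second fundamental form is a multiple of a unit normal vector. -/
theorem exists_scalar_secondFundamentalForm (hF : IsIsometricImmersion F) (p : M) :
    ∃ (ν : EuclideanSpace ℝ (Fin (n + 1)))
      (A : TangentSpace (𝓡 n) p →ₗ[ℝ] TangentSpace (𝓡 n) p →ₗ[ℝ] ℝ), ‖ν‖ = 1 ∧
      ∀ v w, secondFundamentalForm F p v w = A v w • ν := by
  set S := LinearMap.range (differential F p).toLinearMap with hS
  have h1 : Module.finrank ℝ S = n := by
    rw [hS, LinearMap.finrank_range_of_inj (differential_injective hF p), finrank_tangentSpace]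
  -- Codimension one is what turns the vector-valued form into a scalar one.
  have h2 : Module.finrank ℝ Sᗮ = 1 := by
    have := Submodule.finrank_add_finrank_orthogonal S
    rw [h1, finrank_euclideanSpace_fin] at this
    omega
  obtain ⟨u, hu0, hu⟩ := finrank_eq_one_iff'.mp h2
  have hu' : ‖(u : EuclideanSpace ℝ (Fin (n + 1)))‖ ≠ 0 := by
    simpa using hu0
  have hν : ‖(‖(u : EuclideanSpace ℝ (Fin (n + 1)))‖⁻¹ • (u : EuclideanSpace ℝ (Fin (n + 1))))‖
      = 1 := by
    rw [norm_smul, norm_inv, norm_norm, inv_mul_cancel₀ hu']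
  set ν := ‖(u : EuclideanSpace ℝ (Fin (n + 1)))‖⁻¹ • (u : EuclideanSpace ℝ (Fin (n + 1))) with hνd
  refine ⟨ν, (secondFundamentalBilin F p).compr₂ (innerₗ _ ν), hν, fun v w => ?_⟩
  have hmem : secondFundamentalForm F p v w ∈ Sᗮ := Submodule.starProjection_apply_mem _ _
  obtain ⟨c, hc⟩ := hu ⟨_, hmem⟩
  have hc' : secondFundamentalForm F p v w = (c * ‖(u : EuclideanSpace ℝ (Fin (n + 1)))‖) • ν := by
    rw [hνd, smul_smul, mul_assoc, mul_inv_cancel₀ hu', mul_one]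
    exact (congrArg Subtype.val hc).symm
  have : ((secondFundamentalBilin F p).compr₂ (innerₗ _ ν)) v w =
      inner ℝ ν (secondFundamentalForm F p v w) := rfl
  rw [this, hc', inner_smul_right, real_inner_self_eq_norm_sq, hν]
  simp

section Scalar

variable {p : M} {ν : EuclideanSpace ℝ (Fin (n + 1))}
  {A : TangentSpace (𝓡 n) p →ₗ[ℝ] TangentSpace (𝓡 n) p →ₗ[ℝ] ℝ}

theorem biRicOp_eq_gaussBiRic (hF : IsIsometricImmersion F) (hν : ‖ν‖ = 1)
    (hA : ∀ v w, secondFundamentalForm F p v w = A v w • ν) {ι : Type*} [Fintype ι]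
    (e : OrthonormalBasis ι ℝ (TangentSpace (𝓡 n) p)) (α : ℝ) (x y : TangentSpace (𝓡 n) p) :
    biRicOp n α p x y = gaussBiRic α A e x y := by
  have hin : ∀ a b : ℝ, inner ℝ (a • ν) (b • ν) = b * a := fun a b => by
    rw [real_inner_smul_left, inner_smul_right, real_inner_self_eq_norm_sq, hν]; ring
  have hno : ∀ a : ℝ, ‖a • ν‖ ^ 2 = a ^ 2 := fun a => by
    rw [norm_smul, hν, mul_one, Real.norm_eq_abs, sq_abs]
  simp only [biRicOp_eq hF e, gaussBiRic, hA, hin, hno]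

theorem scalar_secondFundamentalForm_comm (hF : IsIsometricImmersion F) (hν : ‖ν‖ = 1)
    (hA : ∀ v w, secondFundamentalForm F p v w = A v w • ν) (v w : TangentSpace (𝓡 n) p) :
    A v w = A w v := by
  have hν0 : ν ≠ 0 := by rintro rfl; simp at hν
  have := secondFundamentalForm_comm hF p v w
  rw [hA, hA] at this
  exact smul_left_injective ℝ hν0 this

omit [IsManifold (𝓡 n) ∞ M] in
theorem normSqA_eq_sum_sq (hν : ‖ν‖ = 1)
    (hA : ∀ v w, secondFundamentalForm F p v w = A v w • ν) {ι : Type*} [Fintype ι]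
    (e : OrthonormalBasis ι ℝ (TangentSpace (𝓡 n) p)) :
    normSqA F p = ∑ i, ∑ j, A (e i) (e j) ^ 2 := by
  rw [← sum_sq_bilin_orthonormalBasis A (stdOrthonormalBasis ℝ (TangentSpace (𝓡 n) p)) e]
  have hno : ∀ a : ℝ, ‖a • ν‖ ^ 2 = a ^ 2 := fun a => by
    rw [norm_smul, hν, mul_one, Real.norm_eq_abs, sq_abs]
  simp only [normSqA, hA, hno]

omit [IsManifold (𝓡 n) ∞ M] in
theorem sq_norm_meanCurvatureVector (hν : ‖ν‖ = 1)
    (hA : ∀ v w, secondFundamentalForm F p v w = A v w • ν) :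
    ‖meanCurvatureVector F p‖ ^ 2 =
      (∑ i, A (stdOrthonormalBasis ℝ (TangentSpace (𝓡 n) p) i)
        (stdOrthonormalBasis ℝ (TangentSpace (𝓡 n) p) i)) ^ 2 := by
  have h : meanCurvatureVector F p =
      (∑ i, A (stdOrthonormalBasis ℝ (TangentSpace (𝓡 n) p) i)
        (stdOrthonormalBasis ℝ (TangentSpace (𝓡 n) p) i)) • ν := by
    simp only [meanCurvatureVector, hA, Finset.sum_smul]
  rw [h, norm_smul, hν, mul_one, Real.norm_eq_abs, sq_abs]

end Scalar

theorem biRicOp_lower_bound (hn3 : 3 ≤ n) (hn5 : n ≤ 5) {H : ℝ} (hF : IsIsometricImmersion F)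
    (hH : HasConstantMeanCurvature F H) {p : M} {x y : TangentSpace (𝓡 n) p}
    (hx : ‖x‖ = 1) (hy : ‖y‖ = 1) (hxy : inner ℝ x y = 0) :
    1 / 1000 * H ^ 2 ≤ aConst n * normSqA F p + biRicOp n (alphaConst n) p x y := by
  obtain ⟨ν, A, hν, hA⟩ := exists_scalar_secondFundamentalForm hF p
  have h := gaussBiRic_lower_bound hn3 hn5 (finrank_tangentSpace (n := n) p) A
    (scalar_secondFundamentalForm_comm hF hν hA)
    (stdOrthonormalBasis ℝ (TangentSpace (𝓡 n) p)) hx hy hxy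
  rwa [← sq_norm_meanCurvatureVector hν hA, hH p, sq_abs, ← normSqA_eq_sum_sq hν hA,
    ← biRicOp_eq_gaussBiRic hF hν hA] at h

omit [IsManifold (𝓡 n) ∞ M] in
theorem exists_orthonormal_pair (hn : 2 ≤ n) (p : M) :
    ∃ x y : TangentSpace (𝓡 n) p, ‖x‖ = 1 ∧ ‖y‖ = 1 ∧ inner ℝ x y = 0 := by
  have h := finrank_tangentSpace (n := n) p
  set e := stdOrthonormalBasis ℝ (TangentSpace (𝓡 n) p)
  refine ⟨e ⟨0, by omega⟩, e ⟨1, by omega⟩, e.norm_eq_one _, e.norm_eq_one _,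
    e.inner_eq_zero (by simp)⟩

theorem biRic_lower_bound (hn3 : 3 ≤ n) (hn5 : n ≤ 5) {H : ℝ} (hF : IsIsometricImmersion F)
    (hH : HasConstantMeanCurvature F H) (p : M) :
    1 / 1000 * H ^ 2 - aConst n * normSqA F p ≤ biRic n (alphaConst n) p := by
  refine le_csInf ?_ ?_
  -- Nonemptiness matters: the real `sInf` of the empty set is 0 by convention.
  · obtain ⟨x, y, hx, hy, hxy⟩ := exists_orthonormal_pair (n := n) (by omega) p
    exact ⟨_, x, y, hx, hy, hxy, rfl⟩
  · rintro r ⟨x, y, hx, hy, hxy, rfl⟩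
    have := biRicOp_lower_bound hn3 hn5 hF hH hx hy hxy
    linarith

/-- The infimum is a genuine lower bound because `biRicOp_lower_bound` bounds the set below; no
compactness is needed. -/
theorem biRic_le (hn3 : 3 ≤ n) (hn5 : n ≤ 5) {H : ℝ} (hF : IsIsometricImmersion F)
    (hH : HasConstantMeanCurvature F H) {p : M} {x y : TangentSpace (𝓡 n) p}
    (hx : ‖x‖ = 1) (hy : ‖y‖ = 1) (hxy : inner ℝ x y = 0) :
    biRic n (alphaConst n) p ≤ biRicOp n (alphaConst n) p x y := by
  refine csInf_le ⟨1 / 1000 * H ^ 2 - aConst n * normSqA F p, ?_⟩ ⟨x, y, hx, hy, hxy, rfl⟩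
  rintro r ⟨x, y, hx, hy, hxy, rfl⟩
  have := biRicOp_lower_bound hn3 hn5 hF hH hx hy hxy
  linarith

end Pointwise
end CMC

/-! ### Orthonormal frames and (semi)continuity of the geometric quantities. -/

namespace CMC
section Frames

/-- Gram–Schmidt orthonormalization depends continuously on parameters. -/
theorem exists_continuousAt_orthonormal {X W : Type*} [TopologicalSpace X] [NormedAddCommGroup W]
    [InnerProductSpace ℝ W] {n : ℕ} {L : X → EuclideanSpace ℝ (Fin n) →L[ℝ] W} {x₀ : X}
    (hL : ContinuousAt L x₀) (hinj : Function.Injective (L x₀)) :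
    ∃ w : Fin n → X → EuclideanSpace ℝ (Fin n), (∀ i, ContinuousAt (w i) x₀) ∧
      ∀ x, Function.Injective (L x) → Orthonormal ℝ (fun i => L x (w i x)) := by
  have hli : ∀ x, Function.Injective (L x) →
      LinearIndependent ℝ (fun i => L x (EuclideanSpace.single i 1)) := by
    intro x hx
    have h := (EuclideanSpace.basisFun (Fin n) ℝ).orthonormal.linearIndependent.map'
      (L x).toLinearMap (LinearMap.ker_eq_bot.mpr hx)
    simpa [Function.comp_def] using h
  -- The Gram–Schmidt vectors are lifted through L to the fixed space ℝⁿ. Denominators are known to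
  -- be nonzero at x₀, which is enough for continuity there.
  have key : ∀ i : Fin n, ∃ v : X → EuclideanSpace ℝ (Fin n), ContinuousAt v x₀ ∧
      ∀ x, L x (v x) =
        InnerProductSpace.gramSchmidt ℝ (fun i => L x (EuclideanSpace.single i 1)) i := by
    intro i
    induction i using WellFoundedLT.induction with
    | _ i ih =>
      choose! v hv1 hv2 using ih
      refine ⟨fun x => EuclideanSpace.single i 1 - ∑ j ∈ Finset.Iio i,
        (inner ℝ (L x (v j x)) (L x (EuclideanSpace.single i 1)) / ‖L x (v j x)‖ ^ 2) • v j x,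
        ?_, fun x => ?_⟩
      · refine continuousAt_const.sub (tendsto_finsetSum _ fun j hj => ?_)
        have hj' := Finset.mem_Iio.mp hj
        have hc := hL.clm_apply (hv1 j hj')
        refine ContinuousAt.smul (ContinuousAt.div ?_ (hc.norm.pow 2) ?_) (hv1 j hj')
        · exact hc.inner (𝕜 := ℝ) (hL.clm_apply continuousAt_const)
        · change ‖L x₀ (v j x₀)‖ ^ 2 ≠ 0
          rw [hv2 j hj']
          exact pow_ne_zero _ (norm_ne_zero_iff.mpr
            (InnerProductSpace.gramSchmidt_ne_zero j (hli x₀ hinj)))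
      · rw [InnerProductSpace.gramSchmidt_def, map_sub, map_sum]
        congr 1
        refine Finset.sum_congr rfl fun j hj => ?_
        rw [map_smul, hv2 j (Finset.mem_Iio.mp hj), Submodule.starProjection_singleton]
        simp
  choose v hv1 hv2 using key
  refine ⟨fun i x => ‖L x (v i x)‖⁻¹ • v i x, fun i => ?_, fun x hx => ?_⟩
  · refine ContinuousAt.smul (ContinuousAt.inv₀ (hL.clm_apply (hv1 i)).norm ?_) (hv1 i)
    rw [hv2 i]
    exact norm_ne_zero_iff.mpr (InnerProductSpace.gramSchmidt_ne_zero i (hli x₀ hinj))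
  · have := InnerProductSpace.gramSchmidtNormed_orthonormal (hli x hx)
    convert this using 2 with i
    rw [map_smul, hv2, InnerProductSpace.gramSchmidtNormed]
    rfl

variable {n : ℕ} {M : Type*} [TopologicalSpace M] [ChartedSpace (EuclideanSpace ℝ (Fin n)) M]
  [RiemannianBundle (fun x : M => TangentSpace (𝓡 n) x)]
  [IsManifold (𝓡 n) ∞ M] {F : M → EuclideanSpace ℝ (Fin (n + 1))}

theorem continuousAt_fderiv_chart (hF : IsIsometricImmersion F) (p₀ : M) :
    ContinuousAt (fun q => fderiv ℝ (F ∘ (extChartAt (𝓡 n) p₀).symm) (extChartAt (𝓡 n) p₀ q)) p₀ :=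
  (contDiffAt_fderiv (contDiffAt_comp_chart_symm le_rfl (mem_extChartAt_target (I := 𝓡 n) p₀)
    (hF.1 _))).continuousAt.comp_of_eq (continuousAt_extChartAt (I := 𝓡 n) p₀) rfl

theorem continuousAt_fderiv_fderiv_chart (hF : IsIsometricImmersion F) (p₀ : M) :
    ContinuousAt (fun q => fderiv ℝ (fderiv ℝ (F ∘ (extChartAt (𝓡 n) p₀).symm))
      (extChartAt (𝓡 n) p₀ q)) p₀ :=
  (contDiffAt_fderiv (contDiffAt_fderiv (contDiffAt_comp_chart_symm le_rfl
    (mem_extChartAt_target (I := 𝓡 n) p₀) (hF.1 _)))).continuousAt.comp_of_eq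
    (continuousAt_extChartAt (I := 𝓡 n) p₀) rfl

/-- Around every point there is an orthonormal frame, continuous at that point. -/
theorem exists_frame (hF : IsIsometricImmersion F) (p₀ : M) :
    ∃ e : ∀ q : M, Fin n → TangentSpace (𝓡 n) q, (∀ᶠ q in nhds p₀, Orthonormal ℝ (e q)) ∧
      ∀ i, ContinuousAt (fun q => chartDeriv p₀ q (e q i)) p₀ := by
  obtain ⟨w, hw1, hw2⟩ := exists_continuousAt_orthonormal (continuousAt_fderiv_chart hF p₀)
    (fderiv_injective hF (mem_extChartAt_target (I := 𝓡 n) p₀))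
  have hsrc := (isOpen_extChartAt_source (I := 𝓡 n) p₀).mem_nhds
    (mem_extChartAt_source (I := 𝓡 n) p₀)
  have hinv : ∀ q ∈ (extChartAt (𝓡 n) p₀).source, ∀ i,
      chartDeriv p₀ q (Function.invFun (chartDeriv p₀ q) (w i q)) = w i q := fun q hq i =>
    Function.rightInverse_invFun (chartDeriv_bijective hq).2 _
  -- Tangent vectors at different points lie in different spaces, so continuity is expressed through
  -- their components in the fixed chart at p₀.
  refine ⟨fun q i => Function.invFun (chartDeriv p₀ q) (w i q), ?_, fun i => ?_⟩
  · filter_upwards [hsrc] with q hq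
    have h := hw2 q (fderiv_injective hF ((extChartAt (𝓡 n) p₀).map_source hq))
    rw [orthonormal_iff_ite] at h ⊢
    intro i j
    rw [← h i j, ← hF.2, differential_eq_fderiv hF hq, differential_eq_fderiv hF hq, hinv q hq,
      hinv q hq]
  · refine (hw1 i).congr ?_
    filter_upwards [hsrc] with q hq
    exact (hinv q hq i).symm

-- An explicit formula through a frame, so that the normal projection can be seen to vary
-- continuously.
omit [IsManifold (𝓡 n) ∞ M] in
theorem starProjection_range_orthogonal (hF : IsIsometricImmersion F) {q : M}
    {e : Fin n → TangentSpace (𝓡 n) q} (he : Orthonormal ℝ e)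
    (w : EuclideanSpace ℝ (Fin (n + 1))) :
    (LinearMap.range (differential F q).toLinearMap)ᗮ.starProjection w =
      w - ∑ k, inner ℝ (differential F q (e k)) w • differential F q (e k) := by
  obtain ⟨b, hb⟩ := exists_orthonormalBasis_of_orthonormal he
  refine Submodule.eq_starProjection_of_mem_orthogonal ?_ ?_
  · rw [Submodule.mem_orthogonal]
    rintro u ⟨v, rfl⟩
    have h : ∀ j, inner ℝ (differential F q (e j))
        (w - ∑ k, inner ℝ (differential F q (e k)) w • differential F q (e k)) = (0 : ℝ) := by
      intro j
      simp [inner_sub_right, inner_sum, inner_smul_right, hF.2, orthonormal_iff_ite.mp he]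
    rw [← b.sum_repr v]
    simp only [ContinuousLinearMap.coe_coe, map_sum, map_smul, sum_inner, real_inner_smul_left, hb,
      h, mul_zero, Finset.sum_const_zero]
  · rw [sub_sub_cancel, Submodule.orthogonal_orthogonal]
    exact Submodule.sum_mem _ fun k _ => Submodule.smul_mem _ _ ⟨_, rfl⟩

theorem continuousAt_secondFundamentalForm_frame (hF : IsIsometricImmersion F) {p₀ : M}
    {e : ∀ q : M, Fin n → TangentSpace (𝓡 n) q} (he : ∀ᶠ q in nhds p₀, Orthonormal ℝ (e q))
    (hc : ∀ i, ContinuousAt (fun q => chartDeriv p₀ q (e q i)) p₀) (i j : Fin n) :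
    ContinuousAt (fun q => secondFundamentalForm F q (e q i) (e q j)) p₀ := by
  set D := fun q => fderiv ℝ (F ∘ (extChartAt (𝓡 n) p₀).symm) (extChartAt (𝓡 n) p₀ q) with hD
  set D2 := fun q => fderiv ℝ (fderiv ℝ (F ∘ (extChartAt (𝓡 n) p₀).symm))
    (extChartAt (𝓡 n) p₀ q) with hD2
  have hDc : ContinuousAt D p₀ := continuousAt_fderiv_chart hF p₀
  have hD2c : ContinuousAt D2 p₀ := continuousAt_fderiv_fderiv_chart hF p₀
  have hcd : ContinuousAt (fun q => D2 q (chartDeriv p₀ q (e q i)) (chartDeriv p₀ q (e q j))) p₀ :=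
    (hD2c.clm_apply (hc i)).clm_apply (hc j)
  have hck : ∀ k, ContinuousAt (fun q => D q (chartDeriv p₀ q (e q k))) p₀ := fun k =>
    hDc.clm_apply (hc k)
  have hev : (fun q => D2 q (chartDeriv p₀ q (e q i)) (chartDeriv p₀ q (e q j)) -
      ∑ k, inner ℝ (D q (chartDeriv p₀ q (e q k)))
        (D2 q (chartDeriv p₀ q (e q i)) (chartDeriv p₀ q (e q j))) •
          D q (chartDeriv p₀ q (e q k))) =ᶠ[nhds p₀]
      fun q => secondFundamentalForm F q (e q i) (e q j) := by
    filter_upwards [he, (isOpen_extChartAt_source (I := 𝓡 n) p₀).mem_nhds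
      (mem_extChartAt_source (I := 𝓡 n) p₀)] with q hq hs
    rw [secondFundamentalForm_eq_of_chart hF hs, starProjection_range_orthogonal hF hq]
    simp only [differential_eq_fderiv hF hs, hD, hD2]
  refine ContinuousAt.congr (hcd.sub (tendsto_finsetSum _ fun k _ => ?_)) hev
  exact ((hck k).inner (𝕜 := ℝ) hcd).smul (hck k)

/-- The basis in `normSqA` is chosen separately at each point; basis independence allows replacing
it near p₀ by a frame continuous at p₀. -/
theorem continuous_normSqA (hF : IsIsometricImmersion F) : Continuous (normSqA F) := by
  rw [continuous_iff_continuousAt]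
  intro p₀
  obtain ⟨e, he, hc⟩ := exists_frame hF p₀
  have hev : (fun q => ∑ i, ∑ j, ‖secondFundamentalForm F q (e q i) (e q j)‖ ^ 2) =ᶠ[nhds p₀]
      normSqA F := by
    filter_upwards [he] with q hq
    obtain ⟨b, hb⟩ := exists_orthonormalBasis_of_orthonormal hq
    obtain ⟨ν, A, hν, hA⟩ := exists_scalar_secondFundamentalForm hF q
    rw [normSqA_eq_sum_sq hν hA b]
    simp only [← hb, hA, norm_smul, hν, mul_one, Real.norm_eq_abs, sq_abs]
  refine ContinuousAt.congr (tendsto_finsetSum _ fun i _ => tendsto_finsetSum _ fun j _ => ?_) hev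
  exact (continuousAt_secondFundamentalForm_frame hF he hc i j).norm.pow 2

theorem norm_sq_eq_sum_sq {V : Type*} [NormedAddCommGroup V] [InnerProductSpace ℝ V]
    [FiniteDimensional ℝ V] {ι : Type*} [Fintype ι] (b : OrthonormalBasis ι ℝ V) (L : V →L[ℝ] ℝ) :
    ‖L‖ ^ 2 = ∑ i, L (b i) ^ 2 := by
  obtain ⟨u, rfl⟩ := (InnerProductSpace.toDual ℝ V).surjective L
  rw [LinearIsometryEquiv.norm_map, ← b.sum_sq_norm_inner_left u]
  simp

theorem continuous_gradSq (hF : IsIsometricImmersion F) {φ : M → ℝ}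
    (hφ : ContMDiff (𝓡 n) 𝓘(ℝ, ℝ) 1 φ) : Continuous (gradSq n φ) := by
  rw [continuous_iff_continuousAt]
  intro p₀
  obtain ⟨e, he, hc⟩ := exists_frame hF p₀
  have hd : ContinuousAt (fun q => fderiv ℝ (φ ∘ (extChartAt (𝓡 n) p₀).symm)
      (extChartAt (𝓡 n) p₀ q)) p₀ :=
    ((contDiffAt_comp_chart_symm ENat.LEInfty.out (mem_extChartAt_target (I := 𝓡 n) p₀)
      (hφ _)).fderiv_right (m := 0) (by simp)).continuousAt.comp_of_eq
      (continuousAt_extChartAt (I := 𝓡 n) p₀) rfl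
  have hev : (fun q => ∑ i, (fderiv ℝ (φ ∘ (extChartAt (𝓡 n) p₀).symm)
      (extChartAt (𝓡 n) p₀ q) (chartDeriv p₀ q (e q i))) ^ 2) =ᶠ[nhds p₀] gradSq n φ := by
    filter_upwards [he, (isOpen_extChartAt_source (I := 𝓡 n) p₀).mem_nhds
      (mem_extChartAt_source (I := 𝓡 n) p₀)] with q hq hs
    obtain ⟨b, hb⟩ := exists_orthonormalBasis_of_orthonormal hq
    refine Eq.trans ?_ (norm_sq_eq_sum_sq b
      (mfderiv (𝓡 n) 𝓘(ℝ, ℝ) φ q : TangentSpace (𝓡 n) q →L[ℝ] ℝ)).symm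
    refine Finset.sum_congr rfl fun i _ => ?_
    rw [hb]
    exact congrArg (fun t : ℝ => t ^ 2)
      (mfderiv_eq_fderiv_comp_chartDeriv (hφ.mdifferentiableAt (by simp)) hs (e q i)).symm
  refine ContinuousAt.congr (tendsto_finsetSum _ fun i _ => ?_) hev
  exact (hd.clm_apply (hc i)).pow 2

/-- A nearly minimizing pair at p₀, extended with constant coefficients in a local frame, stays
orthonormal, and its biRic value varies continuously. Measurability and upper bounds on compact sets
follow. -/
theorem upperSemicontinuous_biRic (hn3 : 3 ≤ n) (hn5 : n ≤ 5) {H : ℝ}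
    (hF : IsIsometricImmersion F) (hH : HasConstantMeanCurvature F H) :
    UpperSemicontinuous (biRic (M := M) n (alphaConst n)) := by
  intro p₀ c hc
  have hne : {r | ∃ x y : TangentSpace (𝓡 n) p₀, ‖x‖ = 1 ∧ ‖y‖ = 1 ∧ inner ℝ x y = 0 ∧
      r = biRicOp n (alphaConst n) p₀ x y}.Nonempty := by
    obtain ⟨x, y, hx, hy, hxy⟩ := exists_orthonormal_pair (n := n) (by omega) p₀
    exact ⟨_, x, y, hx, hy, hxy, rfl⟩
  obtain ⟨_, ⟨x, y, hx, hy, hxy, rfl⟩, hr⟩ := exists_lt_of_csInf_lt hne hc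
  obtain ⟨e, he, hce⟩ := exists_frame hF p₀
  obtain ⟨b, hb⟩ := exists_orthonormalBasis_of_orthonormal he.self_of_nhds
  have hII := continuousAt_secondFundamentalForm_frame hF he hce
  -- a combination of the frame with constant coefficients
  set X : EuclideanSpace ℝ (Fin n) → ∀ q : M, TangentSpace (𝓡 n) q :=
    fun u q => ∑ i, u i • e q i with hX
  have hXin : ∀ u v, ∀ᶠ q in nhds p₀, inner ℝ (X u q) (X v q) = inner ℝ u v := by
    intro u v
    filter_upwards [he] with q hq
    simp [hX, hq.inner_sum, PiLp.inner_apply, mul_comm]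
  have hXb : ∀ v, X (b.repr v) p₀ = v := fun v => by
    simp only [hX, ← hb]; exact b.sum_repr v
  have hexp : ∀ u v q, secondFundamentalForm F q (X u q) (X v q) =
      ∑ i, ∑ j, (u i * v j) • secondFundamentalForm F q (e q i) (e q j) := by
    intro u v q
    change secondFundamentalBilin F q (X u q) (X v q) = _
    simp only [hX, map_sum, map_smul, LinearMap.sum_apply, LinearMap.smul_apply, smul_smul,
      Finset.smul_sum]
    rw [Finset.sum_comm]
    refine Finset.sum_congr rfl fun i _ => Finset.sum_congr rfl fun j _ => ?_
    rw [mul_comm, secondFundamentalBilin_apply]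
  have hIIX : ∀ u v, ContinuousAt (fun q => secondFundamentalForm F q (X u q) (X v q)) p₀ := by
    intro u v
    simp only [hexp]
    exact tendsto_finsetSum _ fun i _ => tendsto_finsetSum _ fun j _ =>
      Filter.Tendsto.const_smul (hII i j) _
  have hXe : ∀ i q, e q i = X (EuclideanSpace.single i 1) q := fun i q => by
    simp [hX]
  set B : M → ℝ := fun q =>
      ∑ i, (inner ℝ (secondFundamentalForm F q (X (b.repr x) q) (X (b.repr x) q))
        (secondFundamentalForm F q (e q i) (e q i)) -
        ‖secondFundamentalForm F q (e q i) (X (b.repr x) q)‖ ^ 2) +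
      alphaConst n * ∑ i, (inner ℝ (secondFundamentalForm F q (X (b.repr y) q) (X (b.repr y) q))
        (secondFundamentalForm F q (e q i) (e q i)) -
        ‖secondFundamentalForm F q (e q i) (X (b.repr y) q)‖ ^ 2) -
      alphaConst n * (inner ℝ (secondFundamentalForm F q (X (b.repr y) q) (X (b.repr y) q))
        (secondFundamentalForm F q (X (b.repr x) q) (X (b.repr x) q)) -
        ‖secondFundamentalForm F q (X (b.repr x) q) (X (b.repr y) q)‖ ^ 2) with hB
  have hBc : ContinuousAt B p₀ := by
    have hsum : ∀ v, ContinuousAt (fun q =>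
        ∑ i, (inner ℝ (secondFundamentalForm F q (X (b.repr v) q) (X (b.repr v) q))
        (secondFundamentalForm F q (e q i) (e q i)) -
        ‖secondFundamentalForm F q (e q i) (X (b.repr v) q)‖ ^ 2)) p₀ := by
      intro v
      refine tendsto_finsetSum _ fun i _ => ?_
      refine ContinuousAt.sub ((hIIX _ _).inner (𝕜 := ℝ) (hII i i)) ?_
      simp only [hXe i]
      exact (hIIX _ _).norm.pow 2
    exact ((hsum x).add ((hsum y).const_mul _)).sub
      ((((hIIX _ _).inner (𝕜 := ℝ) (hIIX _ _)).sub ((hIIX _ _).norm.pow 2)).const_mul _)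
  have hBeq : ∀ᶠ q in nhds p₀,
      biRicOp n (alphaConst n) q (X (b.repr x) q) (X (b.repr y) q) = B q := by
    filter_upwards [he] with q hq
    obtain ⟨b', hb'⟩ := exists_orthonormalBasis_of_orthonormal hq
    rw [biRicOp_eq hF b']
    simp only [hb', hB]
  have hB0 : B p₀ < c := by
    rw [← hBeq.self_of_nhds, hXb, hXb]
    exact hr
  have hnorm : ∀ {q : M} (v : TangentSpace (𝓡 n) q) (u : EuclideanSpace ℝ (Fin n)),
      inner ℝ v v = inner ℝ u u → ‖v‖ = ‖u‖ := by
    intro q v u h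
    rw [norm_eq_sqrt_real_inner, norm_eq_sqrt_real_inner, h]
  filter_upwards [hBc.eventually_lt_const hB0, hBeq, hXin (b.repr x) (b.repr x),
    hXin (b.repr y) (b.repr y), hXin (b.repr x) (b.repr y)] with q h1 h2 h3 h4 h5
  refine (biRic_le hn3 hn5 hF hH ?_ ?_ ?_).trans_lt (h2.trans_lt h1)
  · rw [hnorm _ _ h3, LinearIsometryEquiv.norm_map, hx]
  · rw [hnorm _ _ h4, LinearIsometryEquiv.norm_map, hy]
  · rw [h5, LinearIsometryEquiv.inner_map_map, hxy]

end Frames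
end CMC

/-! ### The Riemannian volume is finite on compact sets. -/

namespace CMC
section Measure
open MeasureTheory Set Manifold
open scoped NNReal ENNReal

variable {n : ℕ} {M : Type*} [MetricSpace M]
  [ChartedSpace (EuclideanSpace ℝ (Fin n)) M] [IsManifold (𝓡 n) ∞ M]
  [RiemannianBundle (fun x : M => TangentSpace (𝓡 n) x)]
  {F : M → EuclideanSpace ℝ (Fin (n + 1))}

omit [IsManifold (𝓡 n) ∞ M] in
theorem norm_differential (hF : IsIsometricImmersion F) {p : M} (v : TangentSpace (𝓡 n) p) :
    ‖differential F p v‖ = ‖v‖ := by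
  rw [norm_eq_sqrt_real_inner, norm_eq_sqrt_real_inner, hF.2]

variable [IsRiemannianManifold (𝓡 n) M]

/-- The inverse of a chart is locally Lipschitz for the Riemannian distance. -/
theorem exists_lipschitzOnWith_chart_symm (hF : IsIsometricImmersion F) (p₀ : M) :
    ∃ (C : ℝ≥0) (r : ℝ), 0 < r ∧
      LipschitzOnWith C (extChartAt (𝓡 n) p₀).symm (Metric.ball (extChartAt (𝓡 n) p₀ p₀) r) := by
  set G := F ∘ (extChartAt (𝓡 n) p₀).symm with hG
  have hGs : ∀ y ∈ (extChartAt (𝓡 n) p₀).target, ContDiffAt ℝ ∞ G y := fun y hy =>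
    contDiffAt_comp_chart_symm le_rfl hy (hF.1 _)
  have hy₀ := mem_extChartAt_target (I := 𝓡 n) p₀
  obtain ⟨r, r_pos, hr⟩ := Metric.mem_nhds_iff.mp (Filter.inter_mem
    ((isOpen_extChartAt_target (I := 𝓡 n) p₀).mem_nhds hy₀)
    ((contDiffAt_fderiv (hGs _ hy₀)).continuousAt.nnnorm.eventually
      (gt_mem_nhds (lt_add_one ‖fderiv ℝ G (extChartAt (𝓡 n) p₀ p₀)‖₊))))
  set C : ℝ≥0 := ‖fderiv ℝ G (extChartAt (𝓡 n) p₀ p₀)‖₊ + 1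
  refine ⟨C, r, r_pos, fun x hx y hy => ?_⟩
  -- The chart image of the segment from x to y has speed |DG(y - x)| ≤ C|y - x|, since dF preserves
  -- norms; its length bounds the distance.
  let η := ContinuousAffineMap.lineMap (R := ℝ) x y
  set γ := (extChartAt (𝓡 n) p₀).symm ∘ η with hγ
  have hη : ∀ t ∈ Icc (0 : ℝ) 1, η t ∈ Metric.ball (extChartAt (𝓡 n) p₀ p₀) r := by
    intro t ht
    exact (convex_ball _ _).segment_subset hx hy
      (by rw [segment_eq_image_lineMap]; exact ⟨t, ht, rfl⟩)
  have η_smooth : ContDiff ℝ 1 η := ContinuousAffineMap.contDiff _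
  have hηd : ∀ t, HasFDerivAt η (fderiv ℝ η t) t := fun t =>
    (η_smooth.differentiable one_ne_zero t).hasFDerivAt
  rw [IsRiemannianManifold.out (I := 𝓡 n)]
  have hle : riemannianEDist (𝓡 n) ((extChartAt (𝓡 n) p₀).symm x) ((extChartAt (𝓡 n) p₀).symm y) ≤
      pathELength (𝓡 n) γ 0 1 := by
    have : IsManifold (𝓡 n) 1 M := IsManifold.of_le (n := ∞) ENat.LEInfty.out
    apply riemannianEDist_le_pathELength _ _ _ zero_le_one
    · exact (contMDiffOn_extChartAt_symm p₀).comp η_smooth.contMDiff.contMDiffOn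
        fun t ht => (hr (hη t ht)).1
    · simp [γ, η, ContinuousAffineMap.coe_lineMap_eq]
    · simp [γ, η, ContinuousAffineMap.coe_lineMap_eq]
  refine hle.trans ?_
  rw [pathELength_eq_lintegral_mfderiv_Icc]
  have hspeed : ∀ t ∈ Icc (0 : ℝ) 1,
      ‖(mfderiv 𝓘(ℝ, ℝ) (𝓡 n) γ t : ℝ →L[ℝ] TangentSpace (𝓡 n) (γ t)) 1‖ₑ ≤ C * edist x y := by
    intro t ht
    have hγd : MDifferentiableAt 𝓘(ℝ, ℝ) (𝓡 n) γ t :=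
      MDifferentiableAt.comp t (mdifferentiableAt_chart_symm (hr (hη t ht)).1)
        (hηd t).differentiableAt.mdifferentiableAt
    have h1 := ((hF.1.mdifferentiableAt (x := γ t) (by simp)).hasMFDerivAt.comp t
      hγd.hasMFDerivAt).mfderiv
    have h2 : HasFDerivAt (F ∘ γ) ((fderiv ℝ G (η t)).comp (fderiv ℝ η t)) t :=
      ((hGs _ (hr (hη t ht)).1).differentiableAt (by simp)).hasFDerivAt.comp t (hηd t)
    rw [mfderiv_eq_fderiv, h2.fderiv] at h1
    have h3 : differential F (γ t)
        ((mfderiv 𝓘(ℝ, ℝ) (𝓡 n) γ t : ℝ →L[ℝ] TangentSpace (𝓡 n) (γ t)) 1) =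
        fderiv ℝ G (η t) (y - x) := by
      have h4 : fderiv ℝ η t 1 = y - x := by simp [η]
      rw [← h4]
      exact (congrArg (fun T : ℝ →L[ℝ] EuclideanSpace ℝ (Fin (n + 1)) => T 1) h1).symm
    rw [← enorm_norm, ← norm_differential hF, h3, enorm_norm, edist_comm, edist_eq_enorm_sub]
    exact ((fderiv ℝ G (η t)).le_opENorm _).trans
      (mul_le_mul_left (ENNReal.coe_le_coe.mpr (hr (hη t ht)).2.le) _)
  refine (setLIntegral_mono' measurableSet_Icc hspeed).trans ?_
  simp

variable [MeasurableSpace M] [BorelSpace M]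

/-- The Riemannian volume is finite on compact sets. -/
theorem isFiniteMeasureOnCompacts_euclideanHausdorffMeasure (hF : IsIsometricImmersion F) :
    IsFiniteMeasureOnCompacts (Measure.euclideanHausdorffMeasure n : Measure M) := by
  have : IsLocallyFiniteMeasure (Measure.euclideanHausdorffMeasure n : Measure M) := by
    refine ⟨fun p₀ => ?_⟩
    obtain ⟨C, r, hr, hC⟩ := exists_lipschitzOnWith_chart_symm hF p₀
    have hsub : (extChartAt (𝓡 n) p₀).source ∩
        extChartAt (𝓡 n) p₀ ⁻¹' Metric.ball (extChartAt (𝓡 n) p₀ p₀) r ⊆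
        (extChartAt (𝓡 n) p₀).symm '' Metric.ball (extChartAt (𝓡 n) p₀ p₀) r := by
      rintro q ⟨hq1, hq2⟩
      exact ⟨_, hq2, (extChartAt (𝓡 n) p₀).left_inv hq1⟩
    refine ⟨_, Filter.inter_mem ((isOpen_extChartAt_source (I := 𝓡 n) p₀).mem_nhds
      (mem_extChartAt_source (I := 𝓡 n) p₀)) ((continuousAt_extChartAt (I := 𝓡 n) p₀).preimage_mem_nhds
        (Metric.ball_mem_nhds _ hr)), (measure_mono hsub).trans_lt ?_⟩
    -- A C-Lipschitz map multiplies n-dimensional Hausdorff measure by at most Cⁿ, and a Euclidean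
    -- ball has finite measure.
    rw [Measure.euclideanHausdorffMeasure_def, Measure.smul_apply, ENNReal.smul_def, smul_eq_mul]
    refine ENNReal.mul_lt_top ENNReal.coe_lt_top
      ((hC.hausdorffMeasure_image_le n.cast_nonneg).trans_lt (ENNReal.mul_lt_top ?_ ?_))
    · exact ENNReal.rpow_lt_top_of_nonneg n.cast_nonneg ENNReal.coe_ne_top
    · exact Metric.isBounded_ball.measure_lt_top
  infer_instance

end Measure
end CMC

/-! ### Test functions with disjoint supports. -/

namespace CMC

section TestFunctions

theorem sq_opNorm_smul {V : Type*} [NormedAddCommGroup V] [NormedSpace ℝ V] (c : ℝ)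
    (T : V →L[ℝ] ℝ) : ‖c • T‖ ^ 2 = c ^ 2 * ‖T‖ ^ 2 := by
  rw [norm_smul, mul_pow, Real.norm_eq_abs, sq_abs]

theorem sq_opNorm_zero {V : Type*} [NormedAddCommGroup V] [NormedSpace ℝ V] :
    ‖(0 : V →L[ℝ] ℝ)‖ ^ 2 = 0 := by simp

variable {n : ℕ} {M : Type*} [TopologicalSpace M] [ChartedSpace (EuclideanSpace ℝ (Fin n)) M]

/-- The space `C¹_c(S)`. -/
def testSubmodule (n : ℕ) {M : Type*} [TopologicalSpace M]
    [ChartedSpace (EuclideanSpace ℝ (Fin n)) M] (S : Set M) : Submodule ℝ (M → ℝ) where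
  carrier := {φ | IsTestFunction n S φ}
  zero_mem' := ⟨contMDiff_const, HasCompactSupport.zero, by
    rw [show (0 : M → ℝ) = fun _ => 0 from rfl, tsupport]; simp⟩
  add_mem' := fun {φ ψ} hφ hψ => ⟨hφ.1.add hψ.1, hφ.2.1.add hψ.2.1,
    (tsupport_add φ ψ).trans (Set.union_subset hφ.2.2 hψ.2.2)⟩
  smul_mem' := fun c φ hφ => ⟨(contMDiff_const (I := 𝓡 n) (I' := 𝓘(ℝ, ℝ)) (c := c)).smul hφ.1, hφ.2.1.smul_left (f := fun _ => c),
    (closure_mono (Function.support_const_smul_subset c φ)).trans hφ.2.2⟩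

theorem IsTestFunction.mono {S T : Set M} (h : S ⊆ T) {φ : M → ℝ} (hφ : IsTestFunction n S φ) :
    IsTestFunction n T φ := ⟨hφ.1, hφ.2.1, hφ.2.2.trans h⟩

variable [RiemannianBundle (fun x : M => TangentSpace (𝓡 n) x)]

theorem gradSq_congr {φ ψ : M → ℝ} {p : M} (h : φ =ᶠ[nhds p] ψ) :
    gradSq n φ p = gradSq n ψ p := by
  have h1 : (mfderiv (𝓡 n) 𝓘(ℝ, ℝ) φ p : TangentSpace (𝓡 n) p →L[ℝ] ℝ) =
      mfderiv (𝓡 n) 𝓘(ℝ, ℝ) ψ p := h.mfderiv_eq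
  exact congrArg (fun T : TangentSpace (𝓡 n) p →L[ℝ] ℝ => ‖T‖ ^ 2) h1

theorem gradSq_smul {φ : M → ℝ} {p : M} (c : ℝ) (hφ : MDifferentiableAt (𝓡 n) 𝓘(ℝ, ℝ) φ p) :
    gradSq n (c • φ) p = c ^ 2 * gradSq n φ p := by
  have h1 : (mfderiv (𝓡 n) 𝓘(ℝ, ℝ) (c • φ) p : TangentSpace (𝓡 n) p →L[ℝ] ℝ) =
      c • (mfderiv (𝓡 n) 𝓘(ℝ, ℝ) φ p : TangentSpace (𝓡 n) p →L[ℝ] ℝ) :=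
    (hφ.hasMFDerivAt.const_smul c).mfderiv
  exact (congrArg (fun T : TangentSpace (𝓡 n) p →L[ℝ] ℝ => ‖T‖ ^ 2) h1).trans
    (sq_opNorm_smul c _)

theorem gradSq_eq_zero {φ : M → ℝ} {p : M} (hp : p ∉ tsupport φ) : gradSq n φ p = 0 := by
  rw [gradSq_congr (notMem_tsupport_iff_eventuallyEq.mp hp)]
  have h1 : (mfderiv (𝓡 n) 𝓘(ℝ, ℝ) (0 : M → ℝ) p : TangentSpace (𝓡 n) p →L[ℝ] ℝ) = 0 :=
    (hasMFDerivAt_const (0 : ℝ) p).mfderiv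
  exact (congrArg (fun T : TangentSpace (𝓡 n) p →L[ℝ] ℝ => ‖T‖ ^ 2) h1).trans
    sq_opNorm_zero

theorem gradSq_nonneg (φ : M → ℝ) (p : M) : 0 ≤ gradSq n φ p := sq_nonneg _

/-- Agreement on a neighbourhood, not merely at p, is what allows gradients to be compared; it holds
because supports are closed. -/
theorem sum_smul_eventuallyEq {ι : Type*} [Fintype ι] {ψ : ι → M → ℝ} (c : ι → ℝ) {p : M} (j : ι)
    (hj : ∀ i, i ≠ j → p ∉ tsupport (ψ i)) : (∑ i, c i • ψ i) =ᶠ[nhds p] c j • ψ j := by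
  classical
  have h : ∀ᶠ q in nhds p, ∀ i, i ≠ j → ψ i q = 0 := by
    rw [Filter.eventually_all]
    intro i
    by_cases hi : i = j
    · simp [hi]
    · filter_upwards [notMem_tsupport_iff_eventuallyEq.mp (hj i hi)] with q hq _ using hq
  filter_upwards [h] with q hq
  rw [Finset.sum_apply, Finset.sum_eq_single j (fun i _ hi => by simp [hq i hi]) (by simp)]

theorem exists_forall_ne_notMem_tsupport {ι : Type*} [Nonempty ι] {ψ : ι → M → ℝ}
    (hd : Pairwise fun i j => Disjoint (tsupport (ψ i)) (tsupport (ψ j))) (p : M) :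
    ∃ j, ∀ i, i ≠ j → p ∉ tsupport (ψ i) := by
  by_cases h : ∃ j, p ∈ tsupport (ψ j)
  · obtain ⟨j, hj⟩ := h
    exact ⟨j, fun i hi hp => Set.disjoint_left.mp (hd hi) hp hj⟩
  · push Not at h
    -- Off all the supports any index will do.
    exact ⟨Classical.arbitrary ι, fun i _ => h i⟩

/-- The energy density of a combination of functions with disjoint supports. -/
theorem energyDensity_sum_smul {F : M → EuclideanSpace ℝ (Fin (n + 1))} {ι : Type*} [Fintype ι]
    [Nonempty ι] {ψ : ι → M → ℝ} (hψ : ∀ i, ContMDiff (𝓡 n) 𝓘(ℝ, ℝ) 1 (ψ i))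
    (hd : Pairwise fun i j => Disjoint (tsupport (ψ i)) (tsupport (ψ j))) (c : ι → ℝ) (p : M) :
    gradSq n (∑ i, c i • ψ i) p - normSqA F p * (∑ i, c i • ψ i) p ^ 2 =
      ∑ i, c i ^ 2 * (gradSq n (ψ i) p - normSqA F p * ψ i p ^ 2) := by
  classical
  obtain ⟨j, hj⟩ := exists_forall_ne_notMem_tsupport hd p
  have hev := sum_smul_eventuallyEq c j hj
  rw [gradSq_congr hev, hev.eq_of_nhds, gradSq_smul _ ((hψ j).mdifferentiableAt (by simp)),
    Finset.sum_eq_single j]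
  · simp only [Pi.smul_apply, smul_eq_mul]; ring
  · intro i _ hi
    rw [gradSq_eq_zero (hj i hi), image_eq_zero_of_notMem_tsupport (hj i hi)]
    ring
  · simp

theorem sq_sum_smul {ι : Type*} [Fintype ι]
    [Nonempty ι] {ψ : ι → M → ℝ}
    (hd : Pairwise fun i j => Disjoint (tsupport (ψ i)) (tsupport (ψ j))) (c : ι → ℝ) (p : M) :
    (∑ i, c i • ψ i) p ^ 2 = ∑ i, c i ^ 2 * ψ i p ^ 2 := by
  classical
  obtain ⟨j, hj⟩ := exists_forall_ne_notMem_tsupport hd p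
  rw [(sum_smul_eventuallyEq c j hj).eq_of_nhds, Finset.sum_eq_single j]
  · simp only [Pi.smul_apply, smul_eq_mul]; ring
  · intro i _ hi
    rw [image_eq_zero_of_notMem_tsupport (hj i hi)]
    ring
  · simp

end TestFunctions

/-! ### Integrability, index and stability at infinity. -/

section Stability
open MeasureTheory

variable {n : ℕ} {M : Type*} [MetricSpace M] [MeasurableSpace M] [BorelSpace M]
  [ChartedSpace (EuclideanSpace ℝ (Fin n)) M] [IsManifold (𝓡 n) ∞ M]
  [RiemannianBundle (fun x : M => TangentSpace (𝓡 n) x)] [IsRiemannianManifold (𝓡 n) M]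
  {F : M → EuclideanSpace ℝ (Fin (n + 1))}

theorem integrable_mul_sq (hF : IsIsometricImmersion F) {f : M → ℝ} (hf : Continuous f)
    {S : Set M} {φ : M → ℝ} (hφ : IsTestFunction n S φ) :
    Integrable (fun p => f p * φ p ^ 2) (Measure.euclideanHausdorffMeasure n) := by
  have := isFiniteMeasureOnCompacts_euclideanHausdorffMeasure hF
  refine (hf.mul (hφ.1.continuous.pow 2)).integrable_of_hasCompactSupport
    (HasCompactSupport.intro hφ.2.1 fun p hp => ?_)
  change f p * φ p ^ 2 = 0
  rw [image_eq_zero_of_notMem_tsupport hp]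
  ring

theorem integrable_sq (hF : IsIsometricImmersion F) {S : Set M} {φ : M → ℝ}
    (hφ : IsTestFunction n S φ) :
    Integrable (fun p => φ p ^ 2) (Measure.euclideanHausdorffMeasure n) := by
  simpa using integrable_mul_sq hF (continuous_const (y := (1 : ℝ))) hφ

theorem integrable_gradSq (hF : IsIsometricImmersion F) {S : Set M} {φ : M → ℝ}
    (hφ : IsTestFunction n S φ) :
    Integrable (gradSq n φ) (Measure.euclideanHausdorffMeasure n) := by
  have := isFiniteMeasureOnCompacts_euclideanHausdorffMeasure hF
  exact (continuous_gradSq hF hφ.1).integrable_of_hasCompactSupport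
    (HasCompactSupport.intro hφ.2.1 fun p hp => gradSq_eq_zero hp)

/-- On the support of φ, biRic is bounded above by semicontinuity and below by a continuous function
of |A|². -/
theorem integrable_biRic_mul_sq (hn3 : 3 ≤ n) (hn5 : n ≤ 5) {H : ℝ}
    (hF : IsIsometricImmersion F) (hH : HasConstantMeanCurvature F H) {S : Set M} {φ : M → ℝ}
    (hφ : IsTestFunction n S φ) :
    Integrable (fun p => biRic n (alphaConst n) p * φ p ^ 2)
      (Measure.euclideanHausdorffMeasure n) := by
  have husc := upperSemicontinuous_biRic hn3 hn5 hF hH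
  obtain ⟨C, hC⟩ := (husc.upperSemicontinuousOn (tsupport φ)).bddAbove_of_isCompact hφ.2.1
  have hcont : Continuous fun p => |C| + |1 / 1000 * H ^ 2 - aConst n * normSqA F p| :=
    continuous_const.add (continuous_const.sub
      (continuous_const.mul (continuous_normSqA hF))).abs
  refine (integrable_mul_sq hF hcont hφ).mono'
    (husc.measurable.mul (hφ.1.continuous.measurable.pow_const 2)).aestronglyMeasurable
    (Filter.Eventually.of_forall fun p => ?_)
  rw [Real.norm_eq_abs, abs_mul, abs_of_nonneg (sq_nonneg (φ p))]
  by_cases hp : p ∈ tsupport φ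
  · refine mul_le_mul_of_nonneg_right ?_ (sq_nonneg _)
    have h1 : biRic n (alphaConst n) p ≤ C := hC ⟨p, hp, rfl⟩
    have h2 := biRic_lower_bound hn3 hn5 hF hH p
    rw [abs_le]
    constructor
    · linarith [neg_abs_le (1 / 1000 * H ^ 2 - aConst n * normSqA F p), abs_nonneg C]
    · linarith [le_abs_self C, abs_nonneg (1 / 1000 * H ^ 2 - aConst n * normSqA F p)]
  · rw [image_eq_zero_of_notMem_tsupport hp]
    simp

theorem jacobiForm_eq (hF : IsIsometricImmersion F) {S : Set M} {φ : M → ℝ}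
    (hφ : IsTestFunction n S φ) :
    jacobiForm F φ = ∫ p, gradSq n φ p ∂(Measure.euclideanHausdorffMeasure n) -
      ∫ p, normSqA F p * φ p ^ 2 ∂(Measure.euclideanHausdorffMeasure n) :=
  integral_sub (integrable_gradSq hF hφ) (integrable_mul_sq hF (continuous_normSqA hF) hφ)

/-- If φ² integrates to 0, the potential term vanishes almost everywhere and only ∫|∇φ|² ≥ 0
remains. This keeps Rayleigh quotients from having denominator 0. -/
theorem integral_sq_pos_of_jacobiForm_neg (hF : IsIsometricImmersion F) {S : Set M} {φ : M → ℝ}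
    (hφ : IsTestFunction n S φ) (hneg : jacobiForm F φ < 0) :
    0 < ∫ p, φ p ^ 2 ∂(Measure.euclideanHausdorffMeasure n) := by
  refine lt_of_le_of_ne (integral_nonneg fun p => sq_nonneg _) fun h0 => hneg.not_ge ?_
  have hae := (integral_eq_zero_iff_of_nonneg (fun p => sq_nonneg _)
    (integrable_sq hF hφ)).mp h0.symm
  refine integral_nonneg_of_ae ?_
  filter_upwards [hae] with p hp
  have hp' : φ p ^ 2 = 0 := hp
  simp only [hp', mul_zero, sub_zero]
  exact gradSq_nonneg _ _

/-- A family of `k` unstable functions with disjoint supports in `Ω` makes the `k`-th Dirichlet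
eigenvalue of `Ω` negative. -/
theorem dirichletEigenvalue_neg (hF : IsIsometricImmersion F) {Ω : Set M} {k : ℕ} (hk : 1 ≤ k)
    {ψ : Fin k → M → ℝ} (hψ : ∀ i, IsTestFunction n Ω (ψ i))
    (hd : Pairwise fun i j => Disjoint (tsupport (ψ i)) (tsupport (ψ j)))
    (hneg : ∀ i, jacobiForm F (ψ i) < 0) : dirichletEigenvalue F Ω k < 0 := by
  have : Nonempty (Fin k) := ⟨⟨0, hk⟩⟩
  have hI := fun i => integral_sq_pos_of_jacobiForm_neg hF (hψ i) (hneg i)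
  set I : Fin k → ℝ := fun i => ∫ p, ψ i p ^ 2 ∂(Measure.euclideanHausdorffMeasure n) with hId
  -- A single negative m bounding all the finitely many Rayleigh quotients, found by letting m tend
  -- to 0 from below; it keeps the supremum strictly negative.
  obtain ⟨m, hmI, hm0⟩ : ∃ m : ℝ, (∀ i, jacobiForm F (ψ i) ≤ m * I i) ∧ m < 0 := by
    have h : ∀ᶠ m in nhdsWithin (0 : ℝ) (Set.Iio 0), ∀ i, jacobiForm F (ψ i) ≤ m * I i := by
      rw [Filter.eventually_all]
      intro i
      have hc : Filter.Tendsto (fun m => m * I i) (nhds 0) (nhds (0 * I i)) :=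
        Filter.tendsto_id.mul_const _
      rw [zero_mul] at hc
      exact (Filter.Eventually.filter_mono nhdsWithin_le_nhds
        (hc.eventually (lt_mem_nhds (hneg i)))).mono fun m hm => hm.le
    exact (h.and self_mem_nhdsWithin).exists
  have hJ : ∀ c : Fin k → ℝ, jacobiForm F (∑ i, c i • ψ i) = ∑ i, c i ^ 2 * jacobiForm F (ψ i) := by
    intro c
    have hint : ∀ i, Integrable (fun p => c i ^ 2 * (gradSq n (ψ i) p - normSqA F p * ψ i p ^ 2))
        (Measure.euclideanHausdorffMeasure n) := fun i =>
      ((integrable_gradSq hF (hψ i)).sub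
        (integrable_mul_sq hF (continuous_normSqA hF) (hψ i))).const_mul _
    simp only [jacobiForm]
    simp_rw [energyDensity_sum_smul (fun i => (hψ i).1) hd c]
    rw [integral_finsetSum _ fun i _ => hint i]
    simp_rw [integral_const_mul]
  have hL2 : ∀ c : Fin k → ℝ, ∫ p, (∑ i, c i • ψ i) p ^ 2 ∂(Measure.euclideanHausdorffMeasure n) =
      ∑ i, c i ^ 2 * I i := by
    intro c
    simp_rw [sq_sum_smul hd c]
    rw [integral_finsetSum _ fun i _ => (integrable_sq hF (hψ i)).const_mul _]
    simp_rw [integral_const_mul, hId]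
  have hpos : ∀ c : Fin k → ℝ, c ≠ 0 → 0 < ∑ i, c i ^ 2 * I i := by
    intro c hc
    obtain ⟨i, hi⟩ := Function.ne_iff.mp hc
    exact Finset.sum_pos' (fun j _ => mul_nonneg (sq_nonneg _) (hI j).le)
      ⟨i, Finset.mem_univ _, mul_pos (by simpa using sq_pos_of_ne_zero hi) (hI i)⟩
  -- A vanishing combination would have zero L² norm, so the span really has dimension k.
  have hli : LinearIndependent ℝ ψ := by
    rw [Fintype.linearIndependent_iff]
    intro c hc
    by_contra hne
    have hc0 : c ≠ 0 := fun h => hne fun i => congrFun h i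
    have h := hL2 c
    rw [hc] at h
    simp only [Pi.zero_apply, ne_eq, OfNat.ofNat_ne_zero, not_false_eq_true, zero_pow,
      integral_zero] at h
    exact (hpos c hc0).ne h
  have hspan : Submodule.span ℝ (Set.range ψ) ≤ testSubmodule n Ω :=
    Submodule.span_le.mpr (by rintro _ ⟨i, rfl⟩; exact hψ i)
  have hrank : Module.finrank ℝ (Submodule.span ℝ (Set.range ψ)) = k := by
    rw [finrank_span_eq_card hli, Fintype.card_fin]
  have htest : ∀ u ∈ Submodule.span ℝ (Set.range ψ), IsTestFunction n Ω u := fun u hu => hspan hu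
  refine (iInf_le_of_le (Submodule.span ℝ (Set.range ψ)) (iInf_le_of_le hrank
    (iInf_le_of_le htest (iSup_le fun u => iSup_le fun hu => iSup_le fun hu0 => ?_)))).trans_lt
    (EReal.coe_lt_coe_iff.mpr hm0)
  obtain ⟨c, rfl⟩ := (Submodule.mem_span_range_iff_exists_fun ℝ).mp hu
  have hc0 : c ≠ 0 := by rintro rfl; simp at hu0
  rw [EReal.coe_le_coe_iff, hJ, hL2, div_le_iff₀ (hpos c hc0), Finset.mul_sum]
  refine Finset.sum_le_sum fun i _ => ?_
  calc c i ^ 2 * jacobiForm F (ψ i) ≤ c i ^ 2 * (m * I i) :=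
        mul_le_mul_of_nonneg_left (hmI i) (sq_nonneg _)
    _ = m * (c i ^ 2 * I i) := by ring

/-- A hypersurface of finite index does not carry an infinite family of unstable functions with
disjoint supports. -/
theorem HasFiniteIndex.exists_jacobiForm_nonneg (hF : IsIsometricImmersion F)
    (hfin : HasFiniteIndex F) {ψ : ℕ → M → ℝ} (hψ : ∀ i, IsTestFunction n Set.univ (ψ i))
    (hd : Pairwise fun i j => Disjoint (tsupport (ψ i)) (tsupport (ψ j))) :
    ∃ i, 0 ≤ jacobiForm F (ψ i) := by
  by_contra! hneg
  obtain ⟨Ω, ⟨hopen, -, hmono, hcover⟩, hsup⟩ := hfin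
  obtain ⟨N, hN⟩ := ENat.ne_top_iff_exists.mp hsup.ne
  have hΩmono : Monotone Ω := monotone_nat_of_le_succ fun i => subset_closure.trans (hmono i)
  have hK : IsCompact (⋃ i : Fin (N + 1), tsupport (ψ i)) :=
    isCompact_iUnion fun i => (hψ i).2.1
  obtain ⟨a, ha⟩ := hK.elim_directed_cover Ω hopen (by rw [hcover]; exact Set.subset_univ _)
    hΩmono.directed_le
  -- If N is the supremum of the indices, N + 1 supports fit in one Ω_a; the first k functions make
  -- λ_k negative for every 1 ≤ k ≤ N + 1.
  have hle : ((N + 1 : ℕ) : ℕ∞) ≤ index F (Ω a) := by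
    have hsub : (Finset.Icc 1 (N + 1) : Set ℕ) ⊆
        {k : ℕ | 1 ≤ k ∧ dirichletEigenvalue F (Ω a) k < 0} := by
      intro k hk
      obtain ⟨hk1, hk2⟩ := Finset.mem_Icc.mp (Finset.mem_coe.mp hk)
      refine ⟨hk1, dirichletEigenvalue_neg hF hk1 (ψ := fun i => ψ i) (fun i => ?_) ?_
        fun i => hneg i⟩
      · exact ⟨(hψ i).1, (hψ i).2.1,
          (Set.subset_iUnion (fun j : Fin (N + 1) => tsupport (ψ j)) (Fin.castLE hk2 i)).trans ha⟩
      · intro i j hij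
        exact hd fun h => hij (Fin.ext h)
    calc ((N + 1 : ℕ) : ℕ∞) = (Finset.Icc 1 (N + 1) : Set ℕ).encard := by
          rw [Set.encard_coe_eq_coe_finsetCard, Nat.card_Icc]; simp
      _ ≤ _ := Set.encard_le_encard hsub
  have h := hle.trans (le_iSup (fun i => index F (Ω i)) a)
  rw [← hN] at h
  exact absurd (Nat.cast_le.mp h) (by omega)

omit [IsManifold (𝓡 n) ∞ M] [IsRiemannianManifold (𝓡 n) M] in
theorem IsStableOn.mono {S T : Set M} (h : S ⊆ T) (hT : IsStableOn F T) : IsStableOn F S :=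
  fun φ hφ => hT φ (hφ.mono h)

/-- A hypersurface of finite index is stable outside a ball. -/
theorem HasFiniteIndex.exists_isStableOn (hF : IsIsometricImmersion F)
    (hfin : HasFiniteIndex F) (o : M) :
    ∃ R₁ : ℝ, 0 < R₁ ∧ ∀ R₀ ≥ R₁, IsStableOn F (Metric.ball o R₀)ᶜ := by
  by_contra! hcon
  have hstep : ∀ R : ℝ, ∃ (φ : M → ℝ) (R' : ℝ), R ≤ R' ∧ IsTestFunction n (Metric.ball o R)ᶜ φ ∧
      tsupport φ ⊆ Metric.ball o R' ∧ jacobiForm F φ < 0 := by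
    intro R
    -- The maximum with 1 provides the positive radius that the negated claim requires.
    obtain ⟨R₀, hR₀, hunst⟩ := hcon (max R 1) (by positivity)
    simp only [IsStableOn, not_forall, not_le] at hunst
    obtain ⟨φ, hφ, hlt⟩ := hunst
    obtain ⟨R', hR', hsub⟩ := hφ.2.1.isBounded.subset_ball_lt R o
    refine ⟨φ, R', hR'.le, hφ.mono ?_, hsub, ?_⟩
    · exact Set.compl_subset_compl.mpr (Metric.ball_subset_ball ((le_max_left _ _).trans hR₀))
    · rw [jacobiForm_eq hF hφ]
      linarith
  choose φ r hr hφ hsub hneg using hstep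
  -- Iterating R ↦ R' from radius 1 places the supports in successive disjoint annuli.
  set ρ : ℕ → ℝ := fun k => r^[k] 1 with hρ
  have hρs : ∀ k, ρ (k + 1) = r (ρ k) := fun k => Function.iterate_succ_apply' r k 1
  have hρm : Monotone ρ := monotone_nat_of_le_succ fun k => (hρs k).symm ▸ hr _
  have hdis : ∀ i j, i < j → Disjoint (tsupport (φ (ρ i))) (tsupport (φ (ρ j))) := by
    intro i j hij
    refine Set.disjoint_of_subset ?_ (hφ (ρ j)).2.2 disjoint_compl_right
    exact (hsub (ρ i)).trans (Metric.ball_subset_ball ((hρs i).symm.le.trans (hρm hij)))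
  obtain ⟨i, hi⟩ := hfin.exists_jacobiForm_nonneg hF (ψ := fun k => φ (ρ k))
    (fun k => (hφ (ρ k)).mono (Set.subset_univ _)) (fun i j hij => by
      rcases lt_or_gt_of_ne hij with h | h
      · exact hdis i j h
      · exact (hdis j i h).symm)
  exact (hneg _).not_ge hi

end Stability

end CMC

/-! ### The main theorem. -/

theorem proposition3p1 (n : ℕ) (hn3 : 3 ≤ n) (hn5 : n ≤ 5) (H : ℝ) (hH : H ≠ 0) :
    ∃ δ : ℝ, 0 < δ ∧
      ∀ (M : Type*) [MetricSpace M] [CompleteSpace M] [NoncompactSpace M]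
        [MeasurableSpace M] [BorelSpace M]
        [ChartedSpace (EuclideanSpace ℝ (Fin n)) M] [IsManifold (𝓡 n) ∞ M]
        [RiemannianBundle (fun x : M => TangentSpace (𝓡 n) x)]
        [IsContinuousRiemannianBundle (EuclideanSpace ℝ (Fin n))
          (fun x : M => TangentSpace (𝓡 n) x)]
        [IsContMDiffRiemannianBundle (𝓡 n) ∞ (EuclideanSpace ℝ (Fin n))
          (fun x : M => TangentSpace (𝓡 n) x)]
        [IsRiemannianManifold (𝓡 n) M]
        (F : M → EuclideanSpace ℝ (Fin (n + 1))) (o : M),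
        CMC.IsIsometricImmersion F →
        CMC.HasConstantMeanCurvature F H →
        CMC.HasFiniteIndex F →
        (∃ R₁ : ℝ, 0 < R₁ ∧ ∀ R₀ ≥ R₁, CMC.IsStableOn F (Metric.ball o R₀)ᶜ) ∧
        ∀ R₀ : ℝ, 0 < R₀ → CMC.IsStableOn F (Metric.ball o R₀)ᶜ →
          ∀ φ : M → ℝ, CMC.IsTestFunction n (Metric.ball o R₀)ᶜ φ →
            MeasureTheory.Integrable (fun p => CMC.gradSq n φ p
              - 1 / CMC.aConst n * (δ - CMC.biRic n (CMC.alphaConst n) p) * φ p ^ 2)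
              (MeasureTheory.Measure.euclideanHausdorffMeasure n) ∧
            0 ≤ ∫ p, (CMC.gradSq n φ p
              - 1 / CMC.aConst n * (δ - CMC.biRic n (CMC.alphaConst n) p) * φ p ^ 2)
              ∂(MeasureTheory.Measure.euclideanHausdorffMeasure n) := by
  -- The constant 1/1000 comes from dimension five; dimensions three and four would allow 1/100.
  refine ⟨1 / 1000 * H ^ 2, by positivity, ?_⟩
  intro M _ _ _ _ _ _ _ _ _ _ _ F o hF hmean hfin
  refine ⟨hfin.exists_isStableOn hF o, fun R₀ _ hstab φ hφ => ?_⟩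
  have ha : 0 < CMC.aConst n := by unfold CMC.aConst; split_ifs <;> norm_num
  have hgrad := CMC.integrable_gradSq hF hφ
  have hA := CMC.integrable_mul_sq hF (CMC.continuous_normSqA hF) hφ
  have hint : MeasureTheory.Integrable (fun p => CMC.gradSq n φ p
      - 1 / CMC.aConst n * (1 / 1000 * H ^ 2 - CMC.biRic n (CMC.alphaConst n) p) * φ p ^ 2)
      (MeasureTheory.Measure.euclideanHausdorffMeasure n) := by
    have h := hgrad.sub ((((CMC.integrable_sq hF hφ).const_mul (1 / 1000 * H ^ 2)).sub
      (CMC.integrable_biRic_mul_sq hn3 hn5 hF hmean hφ)).const_mul (1 / CMC.aConst n))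
    refine h.congr (Filter.Eventually.of_forall fun p => ?_)
    simp only [Pi.sub_apply]
    ring
  refine ⟨hint, ?_⟩
  have hnonneg : 0 ≤ ∫ p, (CMC.gradSq n φ p - CMC.normSqA F p * φ p ^ 2)
      ∂(MeasureTheory.Measure.euclideanHausdorffMeasure n) := by
    rw [MeasureTheory.integral_sub hgrad hA]
    exact sub_nonneg.mpr (hstab φ hφ)
  -- The integrands compare pointwise, as (δ - biRic)/a_n ≤ |A|².
  refine hnonneg.trans (MeasureTheory.integral_mono (hgrad.sub hA) hint fun p => ?_)
  have h1 := CMC.biRic_lower_bound hn3 hn5 hF hmean p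
  have h2 : 1 / CMC.aConst n * (1 / 1000 * H ^ 2 - CMC.biRic n (CMC.alphaConst n) p) ≤
      CMC.normSqA F p := by
    rw [one_div_mul_eq_div, div_le_iff₀ ha]
    linarith
  exact sub_le_sub_left (mul_le_mul_of_nonneg_right h2 (sq_nonneg _)) _
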